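/- Let $g\ge 3$. Let $S_g$ be the closed orientable surface of genus $g$, realised as the double of a planar domain $D$: a closed annulus, whose inner boundary is called hole $1$, with $g-1$ disjoint open discs (holes $2,\dots,g$) removed along a radius, invariant under a reflection $r$ that preserves every hole. The two copies of $D$ are called the front and the back. Let $\iota$ be the hyperelliptic involution of $S_g$, which applies $r$ and exchanges front and back. Let $q_g:\mathcal L\to S_g$ be the regular infinite cyclic cover obtained by unrolling the annulus; $\mathcal L$ is the Jacob's ladder surface, and the group of deck transformations is generated by the handle shift $h_{g-1}$ (to the right by $g-1$ handles). Let $a_j$ ($1\le j\le g$) be the double of an arc in $D$ from hole $j$ to the outer boundary (all on the same side of the axis of $r$, and disjoint from each other), $c_j$ ($1\le j\le g-1$) the double of the arc on that axis from hole $j$ to hole $j+1$, $b_j$ ($2\le j\le g$) a curve on the front around hole $j$, and $\alpha_n$ ($1\le n\le g-2$) the curve on the front that separates the holes $1,\dots,n+1$ from the remaining holes and the outer boundary. Let $T_c$ denote the left Dehn twist about $c$, and let $$G=\{T_{a_1},\dots,T_{a_g},\;T_{b_2},\dots,T_{b_g},\;T_{c_1},\dots,T_{c_{g-1}},\;T_{\alpha_1}T_{\iota(\alpha_1)}^{-1},\dots,T_{\alpha_{g-2}}T_{\iota(\alpha_{g-2})}^{-1},\;\iota\},$$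 a set of isotopy classes of homeomorphisms of $S_g$ (the generators, due to Dey et al., of the group $\mathrm{LMod}_{q_g}(S_g)$ of mapping classes that lift to $\mathcal L$). A lift of a homeomorphism $f$ of $S_g$ is a homeomorphism $\widetilde f$ of $\mathcal L$ with $q_g\circ\widetilde f=f\circ q_g$. (1) Let $n\ge 0$, and for $1\le j\le n$ let $F_j$ be an element of $G$ or the inverse of one, let $f_j$ be a homeomorphism of $S_g$ that represents $F_j$, and let $\widetilde f_j$ be a lift of $f_j$. Put $f=f_1\cdots f_n$, $\widetilde f=\widetilde f_1\cdots\widetilde f_n$, and let $k$ be the number of $j$ with $F_j=\iota$. Then $\widetilde f$ is a lift of $f$, and - $h_{g-1}\circ\widetilde f=\widetilde f\circ h_{g-1}$ if and only if $k$ is even; - $h_{g-1}\circ\widetilde f=\widetilde f\circ h_{g-1}^{-1}$ if and only if $k$ is odd; - consequently, if $k$ is odd, then $\widetilde f^{\,2}$ commutes with $h_{g-1}$. (2) Let $f$ be any homeomorphism of $S_g$ with a lift $\widetilde f$ such that $h_{g-1}\circ\widetilde f\circ h_{g-1}=\widetilde f$. Then $\widetilde f^{\,2}$ is a lift of $f^2$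 and $h_{g-1}\circ\widetilde f^{\,2}\circ h_{g-1}^{-1}=\widetilde f^{\,2}$. -/

import Mathlib

noncomputable section

namespace LadderCover

open Set

/-! ## Lifts, isotopy, mapping classes -/

/-- `f'` is a lift of `f` under `q`. -/
def IsLift {X Y : Type*} [TopologicalSpace X] [TopologicalSpace Y] (q : Y → X)
    (f : X ≃ₜ X) (f' : Y ≃ₜ Y) : Prop :=
  ∀ y, q (f' y) = f (q y)

/-- Two homeomorphisms are isotopic: they are joined by a homotopy through homeomorphisms. -/
def Isotopic {X : Type*} [TopologicalSpace X] (f f' : X ≃ₜ X) : Prop :=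
  ContinuousMap.HomotopicWith (f : C(X, X)) (f' : C(X, X)) (fun k => IsHomeomorph k)

theorem Isotopic.refl {X : Type*} [TopologicalSpace X] (f : X ≃ₜ X) : Isotopic f f :=
  ContinuousMap.HomotopicWith.refl _ f.isHomeomorph

theorem Isotopic.symm {X : Type*} [TopologicalSpace X] {f f' : X ≃ₜ X} (H : Isotopic f f') :
    Isotopic f' f :=
  ContinuousMap.HomotopicWith.symm H

theorem Isotopic.trans {X : Type*} [TopologicalSpace X] {f f' f'' : X ≃ₜ X}
    (H : Isotopic f f') (H' : Isotopic f' f'') : Isotopic f f'' :=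
  ContinuousMap.HomotopicWith.trans H H'

theorem Isotopic.mul {X : Type*} [TopologicalSpace X] {f f' k k' : X ≃ₜ X}
    (H : Isotopic f f') (K : Isotopic k k') : Isotopic (f * k) (f' * k') := by
  obtain ⟨H⟩ := H
  obtain ⟨K⟩ := K
  refine ⟨⟨⟨⟨fun p => H (p.1, K p), by fun_prop⟩, ?_, ?_⟩, ?_⟩⟩
  · intro x
    change H (0, K (0, x)) = f (k x)
    rw [K.apply_zero, H.apply_zero]; rfl
  · intro x
    change H (1, K (1, x)) = f' (k' x)
    rw [K.apply_one, H.apply_one]; rfl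
  · intro t
    exact (H.prop' t).comp (K.prop' t)

/-- Isotopy, as a congruence on the group of self-homeomorphisms of `X`. -/
def isotopyCon (X : Type*) [TopologicalSpace X] : Con (X ≃ₜ X) where
  r := Isotopic
  iseqv := ⟨Isotopic.refl, Isotopic.symm, Isotopic.trans⟩
  mul' := Isotopic.mul

/-- The group of isotopy classes of all self-homeomorphisms of `X` (for an orientable surface, the
extended mapping class group; the mapping class group is the subgroup of the classes that
preserve orientation). -/
abbrev MCG (X : Type*) [TopologicalSpace X] : Type _ := (isotopyCon X).Quotient

/-- The class of a homeomorphism. -/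
def cls {X : Type*} [TopologicalSpace X] (f : X ≃ₜ X) : MCG X := (f : (isotopyCon X).Quotient)

/-! ## Dehn twists -/

/-- The standard left twist `(w, t) ↦ (e^{2πit} w, t)` of the annulus `S¹ × [0,1]`. -/
def stdTwist : Circle × unitInterval ≃ₜ Circle × unitInterval where
  toFun a := (Circle.exp (2 * Real.pi * a.2) * a.1, a.2)
  invFun a := ((Circle.exp (2 * Real.pi * a.2))⁻¹ * a.1, a.2)
  left_inv a := by simp
  right_inv a := by simp
  continuous_toFun := by fun_prop
  continuous_invFun := by fun_prop

/-- A closed annulus embedded in a space `X`, with open interior. -/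
structure Annulus (X : Type*) [TopologicalSpace X] where
  toMap : C(Circle × unitInterval, X)
  inj : Function.Injective toMap
  isOpen_interior : IsOpen (toMap '' {a | (a.2 : ℝ) ∈ Ioo (0 : ℝ) 1})

/-- The image of an annulus under a homeomorphism. -/
def Annulus.map {X : Type*} [TopologicalSpace X] (e : Annulus X) (k : X ≃ₜ X) : Annulus X where
  toMap := (k : C(X, X)).comp e.toMap
  inj := k.injective.comp e.inj
  isOpen_interior := by
    have := k.isOpenMap _ e.isOpen_interior
    rw [Set.image_image] at this
    exact this

open Classical in
/-- Extend a self-map of the annulus by the identity. -/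
def Annulus.extend {X : Type*} [TopologicalSpace X] (e : Annulus X)
    (φ : Circle × unitInterval → Circle × unitInterval) (x : X) : X :=
  if H : ∃ a, e.toMap a = x then e.toMap (φ H.choose) else x

theorem Annulus.extend_apply {X : Type*} [TopologicalSpace X] (e : Annulus X)
    (φ : Circle × unitInterval → Circle × unitInterval) (a : Circle × unitInterval) :
    e.extend φ (e.toMap a) = e.toMap (φ a) := by
  have H : ∃ b, e.toMap b = e.toMap a := ⟨a, rfl⟩
  rw [Annulus.extend, dif_pos H, e.inj H.choose_spec]

theorem Annulus.extend_of_notMem {X : Type*} [TopologicalSpace X] (e : Annulus X)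
    (φ : Circle × unitInterval → Circle × unitInterval) {x : X} (hx : ∀ a, e.toMap a ≠ x) :
    e.extend φ x = x := by
  rw [Annulus.extend, dif_neg (by simpa using hx)]

theorem Annulus.continuous_extend {X : Type*} [TopologicalSpace X] [T2Space X] (e : Annulus X)
    {φ : Circle × unitInterval → Circle × unitInterval} (hφ : Continuous φ)
    (hb : ∀ a, (a.2 : ℝ) ∉ Ioo (0 : ℝ) 1 → φ a = a) : Continuous (e.extend φ) := by
  have hE := e.toMap.continuous.isClosedEmbedding e.inj
  have h1 : ContinuousOn (e.extend φ) (range e.toMap) := by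
    rw [← image_univ, hE.isInducing.continuousOn_image_iff, continuousOn_univ]
    have : e.extend φ ∘ e.toMap = e.toMap ∘ φ := funext (e.extend_apply φ)
    rw [this]
    exact e.toMap.continuous.comp hφ
  have h2 : ContinuousOn (e.extend φ) (e.toMap '' {a | (a.2 : ℝ) ∈ Ioo (0 : ℝ) 1})ᶜ := by
    refine continuousOn_id.congr fun x hx => ?_
    by_cases H : ∃ a, e.toMap a = x
    · obtain ⟨a, rfl⟩ := H
      rw [e.extend_apply, hb a (fun h => hx ⟨a, h, rfl⟩)]; rfl
    · push Not at H
      exact e.extend_of_notMem φ H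
  have h3 := h1.union_of_isClosed h2 hE.isClosed_range e.isOpen_interior.isClosed_compl
  rw [← continuousOn_univ]
  refine h3.mono fun x _ => ?_
  by_cases H : x ∈ range e.toMap
  · exact Or.inl H
  · exact Or.inr fun ⟨a, _, ha⟩ => H ⟨a, ha⟩

theorem Annulus.extend_extend {X : Type*} [TopologicalSpace X] (e : Annulus X)
    {φ ψ : Circle × unitInterval → Circle × unitInterval} (h : ∀ a, φ (ψ a) = a) (x : X) :
    e.extend φ (e.extend ψ x) = x := by
  by_cases H : ∃ a, e.toMap a = x
  · obtain ⟨a, rfl⟩ := H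
    rw [e.extend_apply, e.extend_apply, h]
  · push Not at H
    rw [e.extend_of_notMem ψ H, e.extend_of_notMem φ H]

theorem exp_twist_boundary (t : unitInterval) (ht : (t : ℝ) ∉ Ioo (0 : ℝ) 1) :
    Circle.exp (2 * Real.pi * t) = 1 := by
  have h0 := t.2.1
  have h1 := t.2.2
  rcases h0.eq_or_lt with h | h
  · rw [← h]; simp
  · have : (t : ℝ) = 1 := le_antisymm h1 (not_lt.1 fun h' => ht ⟨h, h'⟩)
    rw [this]; simp

/-- The left Dehn twist along an embedded annulus: `stdTwist` in the annulus, the identity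
outside. -/
def dehnTwist {X : Type*} [TopologicalSpace X] [T2Space X] (e : Annulus X) : X ≃ₜ X where
  toFun := e.extend stdTwist
  invFun := e.extend stdTwist.symm
  left_inv := e.extend_extend stdTwist.left_inv
  right_inv := e.extend_extend stdTwist.right_inv
  continuous_toFun := e.continuous_extend stdTwist.continuous fun a ha => by
    ext1
    · change Circle.exp (2 * Real.pi * a.2) * a.1 = a.1
      rw [exp_twist_boundary _ ha, one_mul]
    · rfl
  continuous_invFun := e.continuous_extend stdTwist.symm.continuous fun a ha => by
    ext1
    · change (Circle.exp (2 * Real.pi * a.2))⁻¹ * a.1 = a.1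
      rw [exp_twist_boundary _ ha, inv_one, one_mul]
    · rfl

/-! ## The closed surface of genus `g`, the ladder, and the covering map

The planar domain is the annulus `{(u, y) : u ∈ S¹, 0 ≤ y ≤ g}` with `g - 1` open discs removed,
centred at `(1, j)` for `j = 1, …, g - 1`.  The closed surface `Surf g` is its double: two copies,
the front `z ≥ 0` and the back `z ≤ 0`, glued along the boundary, realised as `z² = edge g u y`,
where `edge` is positive in the interior of the domain and zero on its boundary.  The `g` holes of
`Surf g` are the boundary circle `y = 0` (hole `0`) and the `g - 1` removed discs (hole `j` for
`1 ≤ j < g`); the outer boundary is `y = g`. -/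

/-- The removed disc number `j` is where this function is negative; with `u = e^{iθ}` the disc is
`2 sin²(θ/2) + 4 (y - j)² < 1 / (j+2)²`. -/
def hole (j : ℕ) (u : Circle) (y : ℝ) : ℝ :=
  (1 - (u : ℂ).re) + (2 * (y - j)) ^ 2 - (1 / ((j : ℝ) + 2)) ^ 2

/-- The annulus with `g - 1` holes. -/
def Plan (g : ℕ) : Set (Circle × ℝ) :=
  {p | 0 ≤ p.2 ∧ p.2 ≤ g ∧ ∀ j ∈ Finset.Ico 1 g, 0 ≤ hole j p.1 p.2}

/-- Nonnegative on `Plan g`, and zero exactly on its boundary. -/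
def edge (g : ℕ) (u : Circle) (y : ℝ) : ℝ :=
  y * (g - y) * ∏ j ∈ Finset.Ico 1 g, hole j u y

/-- The closed orientable surface of genus `g` (`g ≥ 1`), in `S¹ × ℝ × ℝ`. -/
def Surf (g : ℕ) : Set (Circle × ℝ × ℝ) :=
  {p | (p.1, p.2.1) ∈ Plan g ∧ p.2.2 ^ 2 = edge g p.1 p.2.1}

/-- The ladder surface in `ℝ³` (for `g ≥ 2`): the part over `k - 1/2 ≤ x ≤ k + 1/2` is a rung
with `g - 1` handles, for each integer `k`. -/
def Ladder (g : ℕ) : Set (ℝ × ℝ × ℝ) :=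
  {p | (Circle.exp (2 * Real.pi * p.1), p.2.1, p.2.2) ∈ Surf g}

/-- The covering map from the ladder to the closed surface, `(x, y, z) ↦ (e^{2πix}, y, z)`. -/
def cover (g : ℕ) (p : Ladder g) : Surf g :=
  ⟨(Circle.exp (2 * Real.pi * p.1.1), p.1.2.1, p.1.2.2), p.2⟩

theorem exp_shift (x : ℝ) : Circle.exp (2 * Real.pi * (x + 1)) = Circle.exp (2 * Real.pi * x) := by
  rw [mul_add, mul_one, Circle.exp_add_two_pi]

/-- The handle shift to the right by `g - 1` handles, `(x, y, z) ↦ (x + 1, y, z)`; it generates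
the group of deck transformations of `cover g`. -/
def handleShift (g : ℕ) : Ladder g ≃ₜ Ladder g where
  toFun p := ⟨(p.1.1 + 1, p.1.2), by
    have := p.2
    simp only [Ladder, mem_ofPred_eq] at this ⊢
    rwa [exp_shift]⟩
  invFun p := ⟨(p.1.1 - 1, p.1.2), by
    have := p.2
    simp only [Ladder, mem_ofPred_eq] at this ⊢
    rwa [← exp_shift, sub_add_cancel]⟩
  left_inv p := by ext <;> simp
  right_inv p := by ext <;> simp
  continuous_toFun := by fun_prop
  continuous_invFun := by fun_prop

/-- The hyperelliptic involution `(u, y, z) ↦ (ū, y, -z)`: the rotation by `π` about an axis that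
meets the surface in `2g + 2` points. It is covered by the rotation `(x, y, z) ↦ (-x, y, -z)`. -/
def hyperelliptic (g : ℕ) : Surf g ≃ₜ Surf g where
  toFun p := ⟨(p.1.1⁻¹, p.1.2.1, -p.1.2.2), by
    have := p.2
    simpa [Surf, Plan, edge, hole] using this⟩
  invFun p := ⟨(p.1.1⁻¹, p.1.2.1, -p.1.2.2), by
    have := p.2
    simpa [Surf, Plan, edge, hole] using this⟩
  left_inv p := by ext <;> simp
  right_inv p := by ext <;> simp
  continuous_toFun := by fun_prop
  continuous_invFun := by fun_prop

theorem edge_nonneg {g : ℕ} {u : Circle} {y : ℝ} (h : (u, y) ∈ Plan g) : 0 ≤ edge g u y :=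
  mul_nonneg (mul_nonneg h.1 (sub_nonneg.2 h.2.1)) (Finset.prod_nonneg h.2.2)

theorem edge_eq_zero_iff {g : ℕ} {u : Circle} {y : ℝ} :
    edge g u y = 0 ↔ y = 0 ∨ y = g ∨ ∃ j ∈ Finset.Ico 1 g, hole j u y = 0 := by
  rw [edge, mul_eq_zero, mul_eq_zero, sub_eq_zero, Finset.prod_eq_zero_iff, or_assoc,
    eq_comm (a := (g : ℝ))]

theorem continuous_edge (g : ℕ) : Continuous fun p : Circle × ℝ => edge g p.1 p.2 := by
  unfold edge hole
  fun_prop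

theorem rad_pos (j : ℕ) : 0 < 1 / ((j : ℝ) + 2) := by positivity

theorem rad_le_half (j : ℕ) : 1 / ((j : ℝ) + 2) ≤ 1 / 2 := by
  apply one_div_le_one_div_of_le <;> linarith [(Nat.cast_nonneg j : (0 : ℝ) ≤ j)]

theorem rad_anti {i j : ℕ} (h : i ≤ j) : 1 / ((j : ℝ) + 2) ≤ 1 / ((i : ℝ) + 2) := by
  have : (i : ℝ) ≤ j := by exact_mod_cast h
  apply one_div_le_one_div_of_le <;> linarith [(Nat.cast_nonneg i : (0 : ℝ) ≤ i)]

theorem rad_strictAnti (i : ℕ) : 1 / ((i : ℝ) + 3) < 1 / ((i : ℝ) + 2) := by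
  apply one_div_lt_one_div_of_lt <;> linarith [(Nat.cast_nonneg i : (0 : ℝ) ≤ i)]

theorem circle_re_le (u : Circle) : (u : ℂ).re ≤ 1 :=
  (Complex.re_le_norm _).trans (Circle.norm_coe u).le

theorem hole_pos_of_far {j : ℕ} {u : Circle} {y : ℝ} (h : 1 / 4 < (y - j) ^ 2) :
    0 < hole j u y := by
  have h1 := circle_re_le u
  have h2 := rad_le_half j
  have h3 := rad_pos j
  unfold hole
  nlinarith

/-! ### A coordinate around `u = 1` on the circle -/

/-- The point `u = e^{iθ}`, `|θ| ≤ π`, with `√2 sin (θ/2) = X` (for `|X| ≤ √2`). -/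
def xi (X : ℝ) : Circle := Circle.exp (2 * Real.arcsin (X / √2))

/-- The inverse of `xi`. -/
def chi (u : Circle) : ℝ := √2 * Real.sin ((u : ℂ).arg / 2)

theorem continuous_xi : Continuous xi := by
  unfold xi
  exact Circle.exp.continuous.comp (by fun_prop)

theorem sq_le_two {X : ℝ} (h : X ∈ Ioo (-1 : ℝ) 1) : -1 < X / √2 ∧ X / √2 < 1 := by
  have h2 : 1 < √2 := by
    rw [Real.lt_sqrt] <;> norm_num
  constructor
  · rw [lt_div_iff₀ (by linarith)]; linarith [h.1]
  · rw [div_lt_iff₀ (by linarith)]; linarith [h.2]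

theorem xi_re {X : ℝ} (h : X ∈ Ioo (-1 : ℝ) 1) : (xi X : ℂ).re = 1 - X ^ 2 := by
  have h2 := sq_le_two h
  rw [xi, Circle.coe_exp, Complex.exp_ofReal_mul_I_re, Real.cos_two_mul, Real.cos_sq',
    Real.sin_arcsin h2.1.le h2.2.le, div_pow, Real.sq_sqrt (by norm_num)]
  ring

theorem chi_xi {X : ℝ} (h : X ∈ Ioo (-1 : ℝ) 1) : chi (xi X) = X := by
  have h2 := sq_le_two h
  have h3 := Real.arcsin_lt_pi_div_two.2 h2.2
  have h4 := Real.neg_pi_div_two_lt_arcsin.2 h2.1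
  rw [chi, xi, Circle.arg_exp (by linarith) (by linarith), mul_div_cancel_left₀ _ (by norm_num),
    Real.sin_arcsin h2.1.le h2.2.le, mul_div_cancel₀]
  positivity

theorem xi_chi (u : Circle) : xi (chi u) = u := by
  have h1 := Complex.neg_pi_lt_arg (u : ℂ)
  have h2 := Complex.arg_le_pi (u : ℂ)
  rw [chi, xi, mul_div_cancel_left₀ _ (by positivity), Real.arcsin_sin (by linarith) (by linarith),
    mul_div_cancel₀ _ (by norm_num), Circle.exp_arg]

theorem chi_sq (u : Circle) : chi u ^ 2 = 1 - (u : ℂ).re := by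
  have h : (u : ℂ).re = Real.cos (u : ℂ).arg := by
    conv_lhs => rw [← Circle.exp_arg u, Circle.coe_exp, Complex.exp_ofReal_mul_I_re]
  rw [chi, mul_pow, Real.sq_sqrt (by norm_num), Real.sin_sq_eq_half_sub, h,
    mul_div_cancel₀ _ (by norm_num)]
  ring

theorem continuousOn_chi : ContinuousOn chi {u | 0 < (u : ℂ).re} := by
  intro u hu
  apply ContinuousAt.continuousWithinAt
  have h : ContinuousAt (fun u : Circle => (u : ℂ).arg) u :=
    (Complex.continuousAt_arg (Or.inl hu)).comp (by fun_prop : Continuous fun u : Circle => (u : ℂ)).continuousAt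
  unfold chi
  fun_prop

theorem hole_xi (j : ℕ) {X : ℝ} (h : X ∈ Ioo (-1 : ℝ) 1) (y : ℝ) :
    hole j (xi X) y = X ^ 2 + (2 * (y - j)) ^ 2 - (1 / ((j : ℝ) + 2)) ^ 2 := by
  rw [hole, xi_re h]; ring

/-- The set of `(u, y, z)` with `0 < Re u` and `chi u`, `y`, `z` in an open condition is open. -/
theorem isOpen_chart {g : ℕ} {W : Set (ℝ × ℝ × ℝ)} (hW : IsOpen W) :
    IsOpen {p : Surf g | 0 < (p.1.1 : ℂ).re ∧ (chi p.1.1, p.1.2.1, p.1.2.2) ∈ W} := by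
  have ho : IsOpen {p : Surf g | 0 < (p.1.1 : ℂ).re} :=
    isOpen_lt continuous_const (by fun_prop)
  have hc : ContinuousOn (fun p : Surf g => (chi p.1.1, p.1.2.1, p.1.2.2))
      {p : Surf g | 0 < (p.1.1 : ℂ).re} := by
    refine ContinuousOn.prodMk ?_ (by fun_prop)
    exact continuousOn_chi.comp (by fun_prop) fun p hp => hp
  exact hc.isOpen_inter_preimage ho hW

theorem abs_re_le (u : Circle) : -1 ≤ (u : ℂ).re ∧ (u : ℂ).re ≤ 1 := by
  have h := Complex.abs_re_le_norm (u : ℂ)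
  rw [Circle.norm_coe] at h
  exact abs_le.1 h

theorem sq_add_sq (u : Circle) : (u : ℂ).re ^ 2 + (u : ℂ).im ^ 2 = 1 := by
  have h := Circle.normSq_coe u
  rw [Complex.normSq_apply] at h
  nlinarith

theorem circle_ext {u v : Circle} (h1 : (u : ℂ).re = (v : ℂ).re)
    (h2 : 0 < (u : ℂ).im ↔ 0 < (v : ℂ).im) : u = v := by
  have hu := sq_add_sq u
  have hv := sq_add_sq v
  have h3 : ((u : ℂ).im - (v : ℂ).im) * ((u : ℂ).im + (v : ℂ).im) = 0 := by
    rw [h1] at hu; linarith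
  have h4 : (u : ℂ).im = (v : ℂ).im := by
    rcases mul_eq_zero.1 h3 with h | h
    · linarith
    · by_cases h5 : 0 < (u : ℂ).im
      · linarith [h2.1 h5]
      · have h6 := mt h2.2 h5
        linarith
  exact Circle.ext (Complex.ext h1 h4)

theorem exists_circle {c d : ℝ} (h : c ^ 2 + d ^ 2 = 1) :
    ∃ w : Circle, (w : ℂ).re = c ∧ (w : ℂ).im = d := by
  refine ⟨⟨⟨c, d⟩, ?_⟩, rfl, rfl⟩
  rw [Submonoid.unitSphere, Submonoid.mem_mk]
  change (⟨c, d⟩ : ℂ) ∈ Metric.sphere (0 : ℂ) 1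
  rw [mem_sphere_zero_iff_norm, ← sq_eq_sq₀ (norm_nonneg _) zero_le_one,
    ← Complex.normSq_eq_norm_sq, Complex.normSq_apply]
  change c * c + d * d = 1 ^ 2
  linarith

/-! ### Annuli that are doubles of vertical strips -/

/-- A vertical strip `left ≤ X ≤ right`, `lo X ≤ y ≤ hi X` in the planar domain, in the coordinate
`X` around `u = 1`, that meets the boundary of the domain exactly in its lower and upper ends; it is
cut out of the domain by the condition `bot < y < top`. -/
structure Strip (g : ℕ) where
  left : ℝ
  right : ℝ
  lo : ℝ → ℝ
  hi : ℝ → ℝ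
  bot : ℝ
  top : ℝ
  neg_one_lt : -1 < left
  left_lt : left < right
  right_lt : right < 1
  lo_cont : Continuous lo
  hi_cont : Continuous hi
  lo_lt_hi : ∀ X ∈ Icc left right, lo X < hi X
  bot_lt : ∀ X ∈ Icc left right, bot < lo X
  lt_top : ∀ X ∈ Icc left right, hi X < top
  mem_iff : ∀ X ∈ Icc left right, ∀ y ∈ Ioo bot top,
    (xi X, y) ∈ Plan g ↔ y ∈ Icc (lo X) (hi X)
  edge_iff : ∀ X ∈ Icc left right, ∀ y ∈ Icc (lo X) (hi X),
    edge g (xi X) y = 0 ↔ y = lo X ∨ y = hi X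

namespace Strip

variable {g : ℕ} (s : Strip g)

/-- The coordinate `X` at the parameter `t`. -/
def xc (t : unitInterval) : ℝ := s.left + (s.right - s.left) * t

/-- The height `y` at the parameters `w`, `t`: from `lo` at `w = 1` to `hi` at `w = -1`. -/
def yc (a : Circle × unitInterval) : ℝ :=
  (s.lo (s.xc a.2) + s.hi (s.xc a.2)) / 2
    - (s.hi (s.xc a.2) - s.lo (s.xc a.2)) / 2 * (a.1 : ℂ).re

/-- The height `z`: front for `Im w ≥ 0`, back for `Im w ≤ 0`. -/
def zc (a : Circle × unitInterval) : ℝ :=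
  if 0 ≤ (a.1 : ℂ).im then √(edge g (xi (s.xc a.2)) (s.yc a))
  else -√(edge g (xi (s.xc a.2)) (s.yc a))

theorem xc_mem (t : unitInterval) : s.xc t ∈ Icc s.left s.right := by
  have := s.left_lt
  have h0 := t.2.1
  have h1 := t.2.2
  constructor <;> unfold xc <;> nlinarith

theorem mem_one {X : ℝ} (h : X ∈ Icc s.left s.right) : X ∈ Ioo (-1 : ℝ) 1 :=
  ⟨s.neg_one_lt.trans_le h.1, h.2.trans_lt s.right_lt⟩

theorem yc_mem (a : Circle × unitInterval) : s.yc a ∈ Icc (s.lo (s.xc a.2)) (s.hi (s.xc a.2)) := by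
  have h := s.lo_lt_hi _ (s.xc_mem a.2)
  have h1 := abs_re_le a.1
  constructor <;> unfold yc <;> nlinarith

theorem Icc_mem {X y : ℝ} (hX : X ∈ Icc s.left s.right) (hy : y ∈ Icc (s.lo X) (s.hi X)) :
    y ∈ Ioo s.bot s.top :=
  ⟨(s.bot_lt X hX).trans_le hy.1, hy.2.trans_lt (s.lt_top X hX)⟩

theorem plan_mem (a : Circle × unitInterval) : (xi (s.xc a.2), s.yc a) ∈ Plan g :=
  (s.mem_iff _ (s.xc_mem _) _ (s.Icc_mem (s.xc_mem _) (s.yc_mem a))).2 (s.yc_mem a)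

theorem edge_zero {a : Circle × unitInterval} (h : (a.1 : ℂ).im = 0) :
    edge g (xi (s.xc a.2)) (s.yc a) = 0 := by
  rw [s.edge_iff _ (s.xc_mem _) _ (s.yc_mem a)]
  have h1 := sq_add_sq a.1
  rw [h] at h1
  have h2 : ((a.1 : ℂ).re - 1) * ((a.1 : ℂ).re + 1) = 0 := by nlinarith
  rcases mul_eq_zero.1 h2 with h3 | h3
  · left; rw [yc, sub_eq_zero.1 h3]; ring
  · right; rw [yc, eq_neg_of_add_eq_zero_left h3]; ring

theorem im_zero {a : Circle × unitInterval} (h : edge g (xi (s.xc a.2)) (s.yc a) = 0) :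
    (a.1 : ℂ).im = 0 := by
  rw [s.edge_iff _ (s.xc_mem _) _ (s.yc_mem a)] at h
  have h0 := s.lo_lt_hi _ (s.xc_mem a.2)
  have h1 := sq_add_sq a.1
  have h2 : (a.1 : ℂ).re = 1 ∨ (a.1 : ℂ).re = -1 := by
    unfold yc at h
    rcases h with h | h
    · left
      have : (s.hi (s.xc a.2) - s.lo (s.xc a.2)) * ((a.1 : ℂ).re - 1) = 0 := by linarith
      rcases mul_eq_zero.1 this with h3 | h3 <;> linarith
    · right
      have : (s.hi (s.xc a.2) - s.lo (s.xc a.2)) * ((a.1 : ℂ).re + 1) = 0 := by linarith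
      rcases mul_eq_zero.1 this with h3 | h3 <;> linarith
  have : (a.1 : ℂ).im ^ 2 = 0 := by rcases h2 with h2 | h2 <;> rw [h2] at h1 <;> linarith
  exact pow_eq_zero_iff (two_ne_zero) |>.1 this

theorem zc_sq (a : Circle × unitInterval) : s.zc a ^ 2 = edge g (xi (s.xc a.2)) (s.yc a) := by
  have := edge_nonneg (s.plan_mem a)
  unfold zc
  split_ifs
  · exact Real.sq_sqrt this
  · rw [neg_sq, Real.sq_sqrt this]

theorem continuous_xc : Continuous s.xc := by
  unfold xc; fun_prop

theorem continuous_yc : Continuous s.yc := by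
  have h1 := s.lo_cont
  have h2 := s.hi_cont
  have h3 := s.continuous_xc
  unfold yc; fun_prop

theorem continuous_zc : Continuous s.zc := by
  have h1 := s.continuous_xc
  have h2 := s.continuous_yc
  have h3 : Continuous fun a : Circle × unitInterval => edge g (xi (s.xc a.2)) (s.yc a) :=
    (continuous_edge g).comp ((continuous_xi.comp (h1.comp continuous_snd)).prodMk h2)
  unfold zc
  refine Continuous.if_le (by fun_prop) (by fun_prop) continuous_const (by fun_prop) fun a ha => ?_
  rw [s.edge_zero ha.symm]; simp

/-- The double of a strip: an annulus in the surface. The parameter `t` runs from left to right,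
and the parameter `w` upwards on the front, downwards on the back. -/
def toMap : C(Circle × unitInterval, Surf g) where
  toFun a := ⟨(xi (s.xc a.2), s.yc a, s.zc a), s.plan_mem a, s.zc_sq a⟩
  continuous_toFun := by
    have h1 := s.continuous_xc
    have h2 := s.continuous_yc
    have h3 := s.continuous_zc
    have h4 := continuous_xi
    fun_prop

theorem zc_pos_iff (a : Circle × unitInterval) : 0 < s.zc a ↔ 0 < (a.1 : ℂ).im := by
  have h0 := edge_nonneg (s.plan_mem a)
  constructor
  · intro h
    unfold zc at h
    split_ifs at h with h1
    · rcases h1.eq_or_lt with h2 | h2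
      · rw [s.edge_zero h2.symm] at h; simp at h
      · exact h2
    · have := Real.sqrt_nonneg (edge g (xi (s.xc a.2)) (s.yc a))
      linarith
  · intro h
    rw [zc, if_pos h.le, Real.sqrt_pos]
    exact h0.lt_of_ne fun h1 => h.ne' (s.im_zero h1.symm)

theorem injective_toMap : Function.Injective s.toMap := by
  intro a b h
  have hx : xi (s.xc a.2) = xi (s.xc b.2) := congrArg (fun p : Surf g => p.1.1) h
  have hy : s.yc a = s.yc b := congrArg (fun p : Surf g => p.1.2.1) h
  have hz : s.zc a = s.zc b := congrArg (fun p : Surf g => p.1.2.2) h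
  have hx' : s.xc a.2 = s.xc b.2 := by
    rw [← chi_xi (s.mem_one (s.xc_mem a.2)), hx, chi_xi (s.mem_one (s.xc_mem b.2))]
  have ht : a.2 = b.2 := by
    have h1 := s.left_lt
    unfold xc at hx'
    have : (s.right - s.left) * ((a.2 : ℝ) - b.2) = 0 := by linarith
    rcases mul_eq_zero.1 this with h2 | h2
    · linarith
    · exact Subtype.ext (sub_eq_zero.1 h2)
  have hr : (a.1 : ℂ).re = (b.1 : ℂ).re := by
    have h0 := s.lo_lt_hi _ (s.xc_mem b.2)
    unfold yc at hy
    rw [ht] at hy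
    have : (s.hi (s.xc b.2) - s.lo (s.xc b.2)) * ((a.1 : ℂ).re - (b.1 : ℂ).re) = 0 := by linarith
    rcases mul_eq_zero.1 this with h2 | h2 <;> linarith
  refine Prod.ext (circle_ext hr ?_) ht
  rw [← s.zc_pos_iff, ← s.zc_pos_iff, hz]

theorem image_interior : s.toMap '' {a | (a.2 : ℝ) ∈ Ioo (0 : ℝ) 1} =
    {p : Surf g | 0 < (p.1.1 : ℂ).re ∧ (chi p.1.1, p.1.2.1, p.1.2.2) ∈
      {q : ℝ × ℝ × ℝ | (s.left < q.1 ∧ q.1 < s.right) ∧ (s.bot < q.2.1 ∧ q.2.1 < s.top)}} := by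
  have hlr := s.left_lt
  apply Subset.antisymm
  · rintro _ ⟨a, ha, rfl⟩
    have ha : 0 < (a.2 : ℝ) ∧ (a.2 : ℝ) < 1 := ha
    have hm := s.mem_one (s.xc_mem a.2)
    have hy := s.Icc_mem (s.xc_mem a.2) (s.yc_mem a)
    change 0 < (xi (s.xc a.2) : ℂ).re ∧ (s.left < chi (xi (s.xc a.2)) ∧
      chi (xi (s.xc a.2)) < s.right) ∧ (s.bot < s.yc a ∧ s.yc a < s.top)
    rw [xi_re hm, chi_xi hm]
    refine ⟨by nlinarith [hm.1, hm.2], ⟨?_, ?_⟩, hy⟩ <;> unfold xc <;> nlinarith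
  · rintro ⟨⟨u, y, z⟩, hP, hz⟩ ⟨hu, ⟨hl, hr⟩, hy⟩
    simp only at hP hz hu hl hr hy
    have hX : chi u ∈ Icc s.left s.right := ⟨hl.le, hr.le⟩
    have hd : 0 < s.right - s.left := by linarith
    let t : unitInterval := ⟨(chi u - s.left) / (s.right - s.left),
      div_nonneg (by linarith) hd.le, (div_le_one hd).2 (by linarith)⟩
    have ht : s.xc t = chi u := by
      change s.left + (s.right - s.left) * ((chi u - s.left) / (s.right - s.left)) = _
      rw [mul_div_cancel₀ _ hd.ne']; ring
    have hlh := s.lo_lt_hi _ hX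
    have hyI : y ∈ Icc (s.lo (chi u)) (s.hi (chi u)) := by
      rw [← s.mem_iff _ hX y hy, xi_chi]; exact hP
    have hD : 0 < s.hi (chi u) - s.lo (chi u) := by linarith
    set c : ℝ := (s.lo (chi u) + s.hi (chi u) - 2 * y) / (s.hi (chi u) - s.lo (chi u)) with hc
    have hc1 : -1 ≤ c := by rw [hc, le_div_iff₀ hD]; linarith [hyI.2]
    have hc2 : c ≤ 1 := by rw [hc, div_le_iff₀ hD]; linarith [hyI.1]
    have hcs : 0 ≤ 1 - c ^ 2 := by nlinarith
    obtain ⟨w, hwr, hwi⟩ : ∃ w : Circle, (w : ℂ).re = c ∧ (0 ≤ z ↔ 0 ≤ (w : ℂ).im) := by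
      by_cases h : 0 ≤ z
      · obtain ⟨w, h1, h2⟩ := exists_circle (c := c) (d := √(1 - c ^ 2))
          (by rw [Real.sq_sqrt hcs]; ring)
        refine ⟨w, h1, ?_⟩
        rw [h2]
        simp [h, Real.sqrt_nonneg]
      · have hpos : 0 < 1 - c ^ 2 := by
          refine hcs.lt_of_ne fun h0 => h ?_
          have h1 : (c - 1) * (c + 1) = 0 := by linarith
          have h2 : edge g (xi (chi u)) y = 0 := by
            rw [s.edge_iff _ hX _ hyI]
            have hcD : c * (s.hi (chi u) - s.lo (chi u)) = s.lo (chi u) + s.hi (chi u) - 2 * y :=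
              div_mul_cancel₀ _ hD.ne'
            rcases mul_eq_zero.1 h1 with h3 | h3
            · left; rw [sub_eq_zero.1 h3] at hcD; linarith
            · right; rw [eq_neg_of_add_eq_zero_left h3] at hcD; linarith
          rw [xi_chi] at h2
          rw [h2] at hz
          rw [pow_eq_zero_iff (two_ne_zero) |>.1 hz]
        obtain ⟨w, h1, h2⟩ := exists_circle (c := c) (d := -√(1 - c ^ 2))
          (by rw [neg_sq, Real.sq_sqrt hcs]; ring)
        refine ⟨w, h1, ?_⟩
        have := Real.sqrt_pos.2 hpos
        rw [h2]
        constructor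
        · intro h'; exact absurd h' h
        · intro h'; linarith
    have hyc : s.yc (w, t) = y := by
      change (s.lo (s.xc t) + s.hi (s.xc t)) / 2 - (s.hi (s.xc t) - s.lo (s.xc t)) / 2 *
        (w : ℂ).re = y
      rw [ht, hwr]
      have hcD : c * (s.hi (chi u) - s.lo (chi u)) = s.lo (chi u) + s.hi (chi u) - 2 * y :=
        div_mul_cancel₀ _ hD.ne'
      linarith
    have hzc : s.zc (w, t) = z := by
      change (if 0 ≤ (w : ℂ).im then √(edge g (xi (s.xc t)) (s.yc (w, t)))
        else -√(edge g (xi (s.xc t)) (s.yc (w, t)))) = z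
      rw [hyc, ht, xi_chi, ← hz, Real.sqrt_sq_eq_abs]
      by_cases h : 0 ≤ z
      · rw [if_pos (hwi.1 h), abs_of_nonneg h]
      · rw [if_neg (fun h' => h (hwi.2 h')), abs_of_neg (not_le.1 h), neg_neg]
    refine ⟨(w, t), ⟨?_, ?_⟩, ?_⟩
    · exact div_pos (by linarith) hd
    · exact (div_lt_one hd).2 (by linarith)
    · apply Subtype.ext
      change (xi (s.xc t), s.yc (w, t), s.zc (w, t)) = (u, y, z)
      rw [ht, xi_chi, hyc, hzc]

/-- The double of a strip, as an annulus in the surface. -/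
def annulus : Annulus (Surf g) where
  toMap := s.toMap
  inj := s.injective_toMap
  isOpen_interior := by
    rw [s.image_interior]
    refine isOpen_chart (IsOpen.and (IsOpen.and ?_ ?_) (IsOpen.and ?_ ?_)) <;>
      exact isOpen_lt (by fun_prop) (by fun_prop)

end Strip

/-! ### The curves -/

/-- Over the coordinate `X`, the top end of hole `i` (hole `0` ends at `y = 0`). -/
def holeTop (i : ℕ) (X : ℝ) : ℝ :=
  if i = 0 then 0 else i + √((1 / ((i : ℝ) + 2)) ^ 2 - X ^ 2) / 2

/-- Over the coordinate `X`, the lower end of hole `k ≥ 1`. -/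
def holeBot (k : ℕ) (X : ℝ) : ℝ := k - √((1 / ((k : ℝ) + 2)) ^ 2 - X ^ 2) / 2

theorem continuous_holeTop (i : ℕ) : Continuous (holeTop i) := by
  unfold holeTop
  split_ifs <;> fun_prop

theorem continuous_holeBot (i : ℕ) : Continuous (holeBot i) := by
  unfold holeBot
  fun_prop

theorem half_le {i : ℕ} {X : ℝ} :
    0 ≤ √((1 / ((i : ℝ) + 2)) ^ 2 - X ^ 2) ∧ √((1 / ((i : ℝ) + 2)) ^ 2 - X ^ 2) ≤ 1 / 2 := by
  refine ⟨Real.sqrt_nonneg _, Real.sqrt_le_iff.2 ⟨by norm_num, ?_⟩⟩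
  have := rad_pos i
  have := rad_le_half i
  nlinarith

theorem holeTop_le (i : ℕ) (X : ℝ) : (i : ℝ) ≤ holeTop i X ∧ holeTop i X ≤ i + 1 / 4 := by
  have := half_le (i := i) (X := X)
  unfold holeTop
  split_ifs with h
  · rw [h]; norm_num
  · constructor <;> linarith

theorem holeBot_le (i : ℕ) (X : ℝ) : (i : ℝ) - 1 / 4 ≤ holeBot i X ∧ holeBot i X ≤ i := by
  have := half_le (i := i) (X := X)
  unfold holeBot
  constructor <;> linarith

theorem hole_top {i : ℕ} (hi : i ≠ 0) {X y : ℝ} (hX : X ∈ Ioo (-1 : ℝ) 1)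
    (hXi : X ^ 2 < (1 / ((i : ℝ) + 2)) ^ 2) (hy : (i : ℝ) ≤ y) :
    (0 ≤ hole i (xi X) y ↔ holeTop i X ≤ y) ∧ (hole i (xi X) y = 0 ↔ y = holeTop i X) := by
  have h1 := Real.sq_sqrt (sub_nonneg.2 hXi.le)
  have h2 : 0 < √((1 / ((i : ℝ) + 2)) ^ 2 - X ^ 2) := Real.sqrt_pos.2 (sub_pos.2 hXi)
  rw [hole_xi i hX, holeTop, if_neg hi]
  set r := √((1 / ((i : ℝ) + 2)) ^ 2 - X ^ 2)
  have h3 : X ^ 2 + (2 * (y - i)) ^ 2 - (1 / ((i : ℝ) + 2)) ^ 2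
    = (2 * (y - i) - r) * (2 * (y - i) + r) := by linarith
  have h4 : 0 < 2 * (y - i) + r := by linarith
  rw [h3, mul_nonneg_iff_of_pos_right h4, mul_eq_zero, or_iff_left h4.ne']
  constructor <;> constructor <;> intro h <;> linarith

theorem hole_bot {i : ℕ} {X y : ℝ} (hX : X ∈ Ioo (-1 : ℝ) 1)
    (hXi : X ^ 2 < (1 / ((i : ℝ) + 2)) ^ 2) (hy : y ≤ i) :
    (0 ≤ hole i (xi X) y ↔ y ≤ holeBot i X) ∧ (hole i (xi X) y = 0 ↔ y = holeBot i X) := by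
  have h1 := Real.sq_sqrt (sub_nonneg.2 hXi.le)
  have h2 : 0 < √((1 / ((i : ℝ) + 2)) ^ 2 - X ^ 2) := Real.sqrt_pos.2 (sub_pos.2 hXi)
  rw [hole_xi i hX, holeBot]
  set r := √((1 / ((i : ℝ) + 2)) ^ 2 - X ^ 2)
  have h3 : X ^ 2 + (2 * (y - i)) ^ 2 - (1 / ((i : ℝ) + 2)) ^ 2
    = (2 * (i - y) - r) * (2 * (i - y) + r) := by linarith
  have h4 : 0 < 2 * (i - y) + r := by linarith
  rw [h3, mul_nonneg_iff_of_pos_right h4, mul_eq_zero, or_iff_left h4.ne']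
  constructor <;> constructor <;> intro h <;> linarith

theorem lt_holeTop {i : ℕ} (hi : i ≠ 0) {X : ℝ} (hXi : X ^ 2 < (1 / ((i : ℝ) + 2)) ^ 2) :
    (i : ℝ) < holeTop i X := by
  have h2 : 0 < √((1 / ((i : ℝ) + 2)) ^ 2 - X ^ 2) := Real.sqrt_pos.2 (sub_pos.2 hXi)
  rw [holeTop, if_neg hi]; linarith

theorem holeBot_lt {i : ℕ} {X : ℝ} (hXi : X ^ 2 < (1 / ((i : ℝ) + 2)) ^ 2) :
    holeBot i X < i := by
  have h2 : 0 < √((1 / ((i : ℝ) + 2)) ^ 2 - X ^ 2) := Real.sqrt_pos.2 (sub_pos.2 hXi)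
  rw [holeBot]; linarith

theorem hole_pos_above {i j : ℕ} (h : j < i) {u : Circle} {y : ℝ} (hy : (i : ℝ) ≤ y) :
    0 < hole j u y := by
  have : (j : ℝ) + 1 ≤ i := by exact_mod_cast h
  exact hole_pos_of_far (by nlinarith)

theorem hole_pos_below {k j : ℕ} (h : k < j) {u : Circle} {y : ℝ} (hy : y ≤ (k : ℝ)) :
    0 < hole j u y := by
  have : (k : ℝ) + 1 ≤ j := by exact_mod_cast h
  exact hole_pos_of_far (by nlinarith)

/-- For `1 / (i+3) < X < 1 / (i+2)`, the vertical strip on the right that joins hole `i` to the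
outer boundary, missing the holes above. -/
def stripA (g i : ℕ) (hi : i < g) : Strip g where
  left := (2 * (1 / ((i : ℝ) + 3)) + 1 / ((i : ℝ) + 2)) / 3
  right := (1 / ((i : ℝ) + 3) + 2 * (1 / ((i : ℝ) + 2))) / 3
  lo := holeTop i
  hi := fun _ => g
  bot := if i = 0 then -1 else i
  top := g + 1
  neg_one_lt := by
    have : 0 < 1 / ((i : ℝ) + 3) := by positivity
    have := rad_pos i
    linarith
  left_lt := by
    have := rad_strictAnti i
    linarith
  right_lt := by
    have := rad_strictAnti i
    have := rad_le_half i
    linarith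
  lo_cont := continuous_holeTop i
  hi_cont := continuous_const
  lo_lt_hi X _ := by
    have h : (i : ℝ) + 1 ≤ g := by exact_mod_cast hi
    have := (holeTop_le i X).2
    linarith
  bot_lt X hX := by
    split_ifs with h
    · rw [holeTop, if_pos h]; norm_num
    · apply lt_holeTop h
      have h0 : 0 < 1 / ((i : ℝ) + 3) := by positivity
      have h1 := rad_pos i
      have h2 := rad_strictAnti i
      have h3 := hX.1
      have h4 := hX.2
      apply pow_lt_pow_left₀ _ _ two_ne_zero <;> linarith
  lt_top X _ := by linarith
  mem_iff X hX y hy := by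
    have h0 : 0 < 1 / ((i : ℝ) + 3) := by positivity
    have h1 := rad_pos i
    have h2 := rad_strictAnti i
    have h3 := hX.1
    have h4 := hX.2
    have hh := rad_le_half i
    have hX1 : X ∈ Ioo (-1 : ℝ) 1 := ⟨by linarith, by linarith⟩
    have hXi : X ^ 2 < (1 / ((i : ℝ) + 2)) ^ 2 := by
      apply pow_lt_pow_left₀ _ _ two_ne_zero <;> linarith
    have hgt : ∀ j, i < j → 0 < hole j (xi X) y := by
      intro j hj
      have h5 := rad_anti (i := i + 1) (j := j) hj
      push_cast at h5
      rw [show (i : ℝ) + 1 + 2 = i + 3 by ring] at h5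
      have h6 := rad_pos j
      rw [hole_xi j hX1]
      have : (1 / ((j : ℝ) + 2)) ^ 2 < X ^ 2 := by
        apply pow_lt_pow_left₀ _ _ two_ne_zero <;> linarith
      nlinarith [sq_nonneg (2 * (y - j))]
    constructor
    · rintro ⟨h5, h6, h7⟩
      refine ⟨?_, h6⟩
      by_cases h : i = 0
      · rw [holeTop, if_pos h]; exact h5
      · have h8 : (i : ℝ) < y := by simpa [h] using hy.1
        exact (hole_top h hX1 hXi h8.le).1.1
          (h7 i (Finset.mem_Ico.2 ⟨Nat.one_le_iff_ne_zero.2 h, hi⟩))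
    · rintro ⟨h5, h6⟩
      have h7 := (holeTop_le i X).1
      have h8 : (i : ℝ) ≤ y := h7.trans h5
      refine ⟨(Nat.cast_nonneg i).trans h8, h6, fun j hj => ?_⟩
      rcases lt_trichotomy j i with h | h | h
      · exact (hole_pos_above h h8).le
      · subst h
        have hj0 : j ≠ 0 := Nat.one_le_iff_ne_zero.1 (Finset.mem_Ico.1 hj).1
        exact (hole_top hj0 hX1 hXi h8).1.2 h5
      · exact (hgt j h).le
  edge_iff X hX y hy := by
    have h0 : 0 < 1 / ((i : ℝ) + 3) := by positivity
    have h1 := rad_pos i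
    have h2 := rad_strictAnti i
    have h3 := hX.1
    have h4 := hX.2
    have hh := rad_le_half i
    have hX1 : X ∈ Ioo (-1 : ℝ) 1 := ⟨by linarith, by linarith⟩
    have hXi : X ^ 2 < (1 / ((i : ℝ) + 2)) ^ 2 := by
      apply pow_lt_pow_left₀ _ _ two_ne_zero <;> linarith
    have hgt : ∀ j, i < j → 0 < hole j (xi X) y := by
      intro j hj
      have h5 := rad_anti (i := i + 1) (j := j) hj
      push_cast at h5
      rw [show (i : ℝ) + 1 + 2 = i + 3 by ring] at h5
      have h6 := rad_pos j
      rw [hole_xi j hX1]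
      have : (1 / ((j : ℝ) + 2)) ^ 2 < X ^ 2 := by
        apply pow_lt_pow_left₀ _ _ two_ne_zero <;> linarith
      nlinarith [sq_nonneg (2 * (y - j))]
    have h7 := (holeTop_le i X).1
    have h8 : (i : ℝ) ≤ y := h7.trans hy.1
    rw [edge_eq_zero_iff]
    constructor
    · rintro (h | h | ⟨j, hj, h⟩)
      · left
        have : i = 0 := by
          rw [h] at h8
          exact_mod_cast le_antisymm h8 (Nat.cast_nonneg i)
        rw [holeTop, if_pos this, h]
      · exact Or.inr h
      · left
        rcases lt_trichotomy j i with h' | h' | h'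
        · exact absurd h (hole_pos_above h' h8).ne'
        · subst h'
          have hj0 : j ≠ 0 := Nat.one_le_iff_ne_zero.1 (Finset.mem_Ico.1 hj).1
          exact (hole_top hj0 hX1 hXi h8).2.1 h
        · exact absurd h (hgt j h').ne'
    · rintro (h | h)
      · by_cases h' : i = 0
        · left; rw [h, holeTop, if_pos h']
        · right; right
          exact ⟨i, Finset.mem_Ico.2 ⟨Nat.one_le_iff_ne_zero.2 h', hi⟩,
            (hole_top h' hX1 hXi h8).2.2 h⟩
      · exact Or.inr (Or.inl h)

/-- For `|X| ≤ 1 / (2 (i+3))`, the vertical strip that joins hole `i` to hole `i + 1`. -/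
def stripC (g i : ℕ) (hi : i + 1 < g) : Strip g where
  left := -(1 / ((i : ℝ) + 3)) / 2
  right := 1 / ((i : ℝ) + 3) / 2
  lo := holeTop i
  hi := holeBot (i + 1)
  bot := if i = 0 then -1 else i
  top := ((i + 1 : ℕ) : ℝ)
  neg_one_lt := by
    have := rad_strictAnti i
    have := rad_le_half i
    linarith
  left_lt := by
    have : 0 < 1 / ((i : ℝ) + 3) := by positivity
    linarith
  right_lt := by
    have := rad_strictAnti i
    have := rad_le_half i
    linarith
  lo_cont := continuous_holeTop i
  hi_cont := continuous_holeBot (i + 1)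
  lo_lt_hi X _ := by
    have h1 := (holeTop_le i X).2
    have h2 := (holeBot_le (i + 1) X).1
    push_cast at h2
    linarith
  bot_lt X hX := by
    split_ifs with h
    · rw [holeTop, if_pos h]; norm_num
    · apply lt_holeTop h
      have h0 : 0 < 1 / ((i : ℝ) + 3) := by positivity
      have h2 := rad_strictAnti i
      have h3 := hX.1
      have h4 := hX.2
      apply sq_lt_sq' <;> linarith
  lt_top X hX := by
    apply holeBot_lt
    have h0 : 0 < 1 / ((i : ℝ) + 3) := by positivity
    have h3 := hX.1
    have h4 := hX.2
    push_cast
    rw [show (i : ℝ) + 1 + 2 = i + 3 by ring]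
    apply sq_lt_sq' <;> linarith
  mem_iff X hX y hy := by
    have h0 : 0 < 1 / ((i : ℝ) + 3) := by positivity
    have h2 := rad_strictAnti i
    have hh := rad_le_half i
    have h3 := hX.1
    have h4 := hX.2
    have hX1 : X ∈ Ioo (-1 : ℝ) 1 := ⟨by linarith, by linarith⟩
    have hXi : X ^ 2 < (1 / ((i : ℝ) + 2)) ^ 2 := by apply sq_lt_sq' <;> linarith
    have hXk : X ^ 2 < (1 / (((i + 1 : ℕ) : ℝ) + 2)) ^ 2 := by
      push_cast
      rw [show (i : ℝ) + 1 + 2 = i + 3 by ring]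
      apply sq_lt_sq' <;> linarith
    have hyk : y ≤ ((i + 1 : ℕ) : ℝ) := hy.2.le
    have hyg : y ≤ g := hyk.trans (by exact_mod_cast hi.le)
    constructor
    · rintro ⟨h5, h6, h7⟩
      refine ⟨?_, (hole_bot hX1 hXk hyk).1.1 (h7 _ (Finset.mem_Ico.2 ⟨by lia, hi⟩))⟩
      by_cases h : i = 0
      · rw [holeTop, if_pos h]; exact h5
      · have h8 : (i : ℝ) < y := by simpa [h] using hy.1
        exact (hole_top h hX1 hXi h8.le).1.1
          (h7 i (Finset.mem_Ico.2 ⟨Nat.one_le_iff_ne_zero.2 h, by lia⟩))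
    · rintro ⟨h5, h6⟩
      have h7 := (holeTop_le i X).1
      have h8 : (i : ℝ) ≤ y := h7.trans h5
      refine ⟨(Nat.cast_nonneg i).trans h8, hyg, fun j hj => ?_⟩
      rcases lt_trichotomy j i with h | h | h
      · exact (hole_pos_above h h8).le
      · subst h
        have hj0 : j ≠ 0 := Nat.one_le_iff_ne_zero.1 (Finset.mem_Ico.1 hj).1
        exact (hole_top hj0 hX1 hXi h8).1.2 h5
      · rcases (Nat.succ_le_of_lt h).eq_or_lt with h' | h'
        · subst h'
          exact (hole_bot hX1 hXk hyk).1.2 h6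
        · exact (hole_pos_below h' hyk).le
  edge_iff X hX y hy := by
    have h0 : 0 < 1 / ((i : ℝ) + 3) := by positivity
    have h2 := rad_strictAnti i
    have hh := rad_le_half i
    have h3 := hX.1
    have h4 := hX.2
    have hX1 : X ∈ Ioo (-1 : ℝ) 1 := ⟨by linarith, by linarith⟩
    have hXi : X ^ 2 < (1 / ((i : ℝ) + 2)) ^ 2 := by apply sq_lt_sq' <;> linarith
    have hXk : X ^ 2 < (1 / (((i + 1 : ℕ) : ℝ) + 2)) ^ 2 := by
      push_cast
      rw [show (i : ℝ) + 1 + 2 = i + 3 by ring]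
      apply sq_lt_sq' <;> linarith
    have hyk : y < ((i + 1 : ℕ) : ℝ) := hy.2.trans_lt (holeBot_lt hXk)
    have hyg : y < g := hyk.trans (by exact_mod_cast hi)
    have h7 := (holeTop_le i X).1
    have h8 : (i : ℝ) ≤ y := h7.trans hy.1
    rw [edge_eq_zero_iff]
    constructor
    · rintro (h | h | ⟨j, hj, h⟩)
      · left
        have : i = 0 := by
          rw [h] at h8
          exact_mod_cast le_antisymm h8 (Nat.cast_nonneg i)
        rw [holeTop, if_pos this, h]
      · exact absurd h hyg.ne
      · rcases lt_trichotomy j i with h' | h' | h'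
        · exact absurd h (hole_pos_above h' h8).ne'
        · subst h'
          have hj0 : j ≠ 0 := Nat.one_le_iff_ne_zero.1 (Finset.mem_Ico.1 hj).1
          exact Or.inl ((hole_top hj0 hX1 hXi h8).2.1 h)
        · rcases (Nat.succ_le_of_lt h').eq_or_lt with h9 | h9
          · subst h9
            exact Or.inr ((hole_bot hX1 hXk hyk.le).2.1 h)
          · exact absurd h (hole_pos_below h9 hyk.le).ne'
    · rintro (h | h)
      · by_cases h' : i = 0
        · left; rw [h, holeTop, if_pos h']
        · right; right
          exact ⟨i, Finset.mem_Ico.2 ⟨Nat.one_le_iff_ne_zero.2 h', by lia⟩,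
            (hole_top h' hX1 hXi h8).2.2 h⟩
      · right; right
        exact ⟨i + 1, Finset.mem_Ico.2 ⟨by lia, hi⟩, (hole_bot hX1 hXk hyk.le).2.2 h⟩

theorem edge_pos {g : ℕ} {u : Circle} {y : ℝ} (h0 : 0 < y) (hg : y < g)
    (h : ∀ j ∈ Finset.Ico 1 g, 0 < hole j u y) : (u, y) ∈ Plan g ∧ 0 < edge g u y :=
  ⟨⟨h0.le, hg.le, fun j hj => (h j hj).le⟩,
    mul_pos (mul_pos h0 (sub_pos.2 hg)) (Finset.prod_pos h)⟩

/-- The radii of the circles around hole `j`, in the coordinates `X`, `2 (y - j)`; the hole itself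
has radius `1 / (j+2)`. -/
def radB (j : ℕ) (t : ℝ) : ℝ := 1 / ((j : ℝ) + 2) + (1 - 1 / ((j : ℝ) + 2)) * ((1 + t) / 3)

theorem radB_mem (j : ℕ) {t : ℝ} (ht : t ∈ Icc (0 : ℝ) 1) :
    1 / ((j : ℝ) + 2) < radB j t ∧ radB j t < 1 := by
  have h1 := rad_le_half j
  have h2 := ht.1
  have h3 := ht.2
  unfold radB
  constructor <;> nlinarith

theorem radB_bounds {r : ℝ} {w : Circle} (h0 : 0 < r) (h1 : r < 1) :
    r * (w : ℂ).re ∈ Ioo (-1 : ℝ) 1 ∧ r * (w : ℂ).im ∈ Ioo (-1 : ℝ) 1 ∧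
      (r * (w : ℂ).re) ^ 2 + (r * (w : ℂ).im) ^ 2 = r ^ 2 := by
  have h := sq_add_sq w
  have h2 : (r * (w : ℂ).re) ^ 2 + (r * (w : ℂ).im) ^ 2 = r ^ 2 := by
    rw [mul_pow, mul_pow, ← mul_add, h, mul_one]
  have h3 : r ^ 2 < 1 := by nlinarith
  refine ⟨abs_lt.1 ?_, abs_lt.1 ?_, h2⟩ <;> rw [← sq_lt_one_iff_abs_lt_one] <;>
    nlinarith [sq_nonneg (r * (w : ℂ).re), sq_nonneg (r * (w : ℂ).im)]

theorem planB {g j : ℕ} (hj : j ∈ Finset.Ico 1 g) {X Y : ℝ} (hX : X ∈ Ioo (-1 : ℝ) 1)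
    (hY : Y ∈ Ioo (-1 : ℝ) 1) (hr : (1 / ((j : ℝ) + 2)) ^ 2 < X ^ 2 + Y ^ 2) :
    (xi X, j + Y / 2) ∈ Plan g ∧ 0 < edge g (xi X) (j + Y / 2) := by
  obtain ⟨h1, h2⟩ := Finset.mem_Ico.1 hj
  have h1 : (1 : ℝ) ≤ j := by exact_mod_cast h1
  have h2 : (j : ℝ) + 1 ≤ g := by exact_mod_cast h2
  have h3 := hY.1
  have h4 := hY.2
  refine edge_pos (by linarith) (by linarith) fun k _ => ?_
  rcases lt_trichotomy k j with h | h | h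
  · have : (k : ℝ) + 1 ≤ j := by exact_mod_cast h
    exact hole_pos_of_far (by nlinarith)
  · subst h
    rw [hole_xi k hX]
    have : (2 * ((k : ℝ) + Y / 2 - k)) ^ 2 = Y ^ 2 := by ring
    linarith
  · have : (j : ℝ) + 1 ≤ k := by exact_mod_cast h
    exact hole_pos_of_far (by nlinarith)

theorem planB' {g j : ℕ} (hj : j ∈ Finset.Ico 1 g) (a : Circle × unitInterval) :
    (xi (radB j a.2 * (a.1 : ℂ).re), j + radB j a.2 * (a.1 : ℂ).im / 2) ∈ Plan g ∧
      0 < edge g (xi (radB j a.2 * (a.1 : ℂ).re)) (j + radB j a.2 * (a.1 : ℂ).im / 2) := by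
  have h1 := radB_mem j a.2.2
  have h0 := rad_pos j
  obtain ⟨h2, h3, h4⟩ := radB_bounds (w := a.1) (h0.trans h1.1) h1.2
  refine planB hj h2 h3 ?_
  rw [h4]
  exact pow_lt_pow_left₀ h1.1 h0.le two_ne_zero

/-- The annulus around hole `j`, `1 ≤ j < g`, on the front. -/
def mapB (g j : ℕ) (hj : j ∈ Finset.Ico 1 g) : C(Circle × unitInterval, Surf g) where
  toFun a := ⟨(xi (radB j a.2 * (a.1 : ℂ).re), j + radB j a.2 * (a.1 : ℂ).im / 2,
    √(edge g (xi (radB j a.2 * (a.1 : ℂ).re)) (j + radB j a.2 * (a.1 : ℂ).im / 2))),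
    (planB' hj a).1, Real.sq_sqrt (planB' hj a).2.le⟩
  continuous_toFun := by
    have h1 : Continuous fun a : Circle × unitInterval => xi (radB j a.2 * (a.1 : ℂ).re) := by
      unfold radB
      exact continuous_xi.comp (by fun_prop)
    have h2 : Continuous fun a : Circle × unitInterval =>
        (j : ℝ) + radB j a.2 * (a.1 : ℂ).im / 2 := by
      unfold radB
      fun_prop
    have h3 := (continuous_edge g).comp (h1.prodMk h2)
    exact (h1.prodMk (h2.prodMk h3.sqrt)).subtype_mk _

theorem radB_strictMono (j : ℕ) : StrictMono (radB j) := by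
  intro s t h
  have := rad_le_half j
  unfold radB
  nlinarith

theorem mapB_injective (g j : ℕ) (hj : j ∈ Finset.Ico 1 g) : Function.Injective (mapB g j hj) := by
  intro a b h
  have ha := radB_mem j a.2.2
  have hb := radB_mem j b.2.2
  have h0 := rad_pos j
  obtain ⟨a1, a2, a3⟩ := radB_bounds (w := a.1) (h0.trans ha.1) ha.2
  obtain ⟨b1, b2, b3⟩ := radB_bounds (w := b.1) (h0.trans hb.1) hb.2
  have hx : xi (radB j a.2 * (a.1 : ℂ).re) = xi (radB j b.2 * (b.1 : ℂ).re) :=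
    congrArg (fun p : Surf g => p.1.1) h
  have hy : (j : ℝ) + radB j a.2 * (a.1 : ℂ).im / 2 = j + radB j b.2 * (b.1 : ℂ).im / 2 :=
    congrArg (fun p : Surf g => p.1.2.1) h
  have hx' : radB j a.2 * (a.1 : ℂ).re = radB j b.2 * (b.1 : ℂ).re := by
    rw [← chi_xi a1, hx, chi_xi b1]
  have hy' : radB j a.2 * (a.1 : ℂ).im = radB j b.2 * (b.1 : ℂ).im := by linarith
  have hr : radB j a.2 = radB j b.2 := by
    rw [hx', hy', b3] at a3
    exact (pow_left_inj₀ (h0.trans hb.1).le (h0.trans ha.1).le two_ne_zero).1 a3 |>.symm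
  have hp : radB j b.2 ≠ 0 := (h0.trans hb.1).ne'
  rw [hr] at hx' hy'
  exact Prod.ext (Circle.ext (Complex.ext (mul_left_cancel₀ hp hx') (mul_left_cancel₀ hp hy')))
    (Subtype.ext ((radB_strictMono j).injective hr))

theorem mapB_image (g j : ℕ) (hj : j ∈ Finset.Ico 1 g) :
    mapB g j hj '' {a | (a.2 : ℝ) ∈ Ioo (0 : ℝ) 1} =
    {p : Surf g | 0 < (p.1.1 : ℂ).re ∧ (chi p.1.1, p.1.2.1, p.1.2.2) ∈
      {q : ℝ × ℝ × ℝ | 0 < q.2.2 ∧ (radB j 0 ^ 2 < q.1 ^ 2 + (2 * (q.2.1 - j)) ^ 2 ∧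
        q.1 ^ 2 + (2 * (q.2.1 - j)) ^ 2 < radB j 1 ^ 2)}} := by
  have h0 := rad_pos j
  have hr0 := radB_mem j (t := 0) ⟨le_rfl, zero_le_one⟩
  have hr1 := radB_mem j (t := 1) ⟨zero_le_one, le_rfl⟩
  have h01 := radB_strictMono j zero_lt_one
  apply Subset.antisymm
  · rintro _ ⟨a, ⟨ht0, ht1⟩, rfl⟩
    have ha := radB_mem j a.2.2
    obtain ⟨a1, a2, a3⟩ := radB_bounds (w := a.1) (h0.trans ha.1) ha.2
    change 0 < (xi (radB j a.2 * (a.1 : ℂ).re) : ℂ).re ∧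
      0 < √(edge g (xi (radB j a.2 * (a.1 : ℂ).re)) (j + radB j a.2 * (a.1 : ℂ).im / 2)) ∧
      (radB j 0 ^ 2 < chi (xi (radB j a.2 * (a.1 : ℂ).re)) ^ 2 +
        (2 * (j + radB j a.2 * (a.1 : ℂ).im / 2 - j)) ^ 2 ∧
      chi (xi (radB j a.2 * (a.1 : ℂ).re)) ^ 2 +
        (2 * (j + radB j a.2 * (a.1 : ℂ).im / 2 - j)) ^ 2 < radB j 1 ^ 2)
    have e : (2 * (j + radB j a.2 * (a.1 : ℂ).im / 2 - j)) ^ 2 =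
      (radB j a.2 * (a.1 : ℂ).im) ^ 2 := by ring
    rw [xi_re a1, chi_xi a1, e, a3]
    refine ⟨by nlinarith [a1.1, a1.2], Real.sqrt_pos.2 (planB' hj a).2, ?_, ?_⟩
    · exact pow_lt_pow_left₀ (radB_strictMono j ht0) (h0.trans hr0.1).le two_ne_zero
    · exact pow_lt_pow_left₀ (radB_strictMono j ht1) (h0.trans ha.1).le two_ne_zero
  · rintro ⟨⟨u, y, z⟩, hP, hz⟩ ⟨hu, hz0, hl, hr⟩
    simp only at hP hz hu hz0 hl hr
    set X := chi u with hX
    set Y := 2 * (y - j) with hY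
    have hN0 : 0 ≤ X ^ 2 + Y ^ 2 := by positivity
    set N := √(X ^ 2 + Y ^ 2) with hN
    have hNs : N ^ 2 = X ^ 2 + Y ^ 2 := Real.sq_sqrt hN0
    rw [← hNs] at hl hr
    have hl' : radB j 0 < N := lt_of_pow_lt_pow_left₀ 2 (Real.sqrt_nonneg _) hl
    have hr' : N < radB j 1 := lt_of_pow_lt_pow_left₀ 2 (h0.trans hr1.1).le hr
    have hNp : 0 < N := (h0.trans hr0.1).trans hl'
    have hd : 0 < radB j 1 - radB j 0 := by linarith
    have hT0 : 0 < (N - radB j 0) / (radB j 1 - radB j 0) := div_pos (by linarith) hd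
    have hT1 : (N - radB j 0) / (radB j 1 - radB j 0) < 1 := (div_lt_one hd).2 (by linarith)
    let t : unitInterval := ⟨_, hT0.le, hT1.le⟩
    have ht : radB j t = N := by
      have e : ∀ s : ℝ, radB j s = radB j 0 + s * (radB j 1 - radB j 0) := by
        intro s; unfold radB; ring
      rw [e]
      change radB j 0 + (N - radB j 0) / (radB j 1 - radB j 0) * (radB j 1 - radB j 0) = N
      rw [div_mul_cancel₀ _ hd.ne']; ring
    obtain ⟨w, hw1, hw2⟩ := exists_circle (c := X / N) (d := Y / N) (by
      rw [div_pow, div_pow, ← add_div, ← hNs, div_self (by positivity)])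
    have e1 : radB j t * (w : ℂ).re = X := by rw [ht, hw1, mul_div_cancel₀ _ hNp.ne']
    have e2 : (j : ℝ) + radB j t * (w : ℂ).im / 2 = y := by
      rw [ht, hw2, mul_div_cancel₀ _ hNp.ne', hY]; ring
    refine ⟨(w, t), ⟨hT0, hT1⟩, Subtype.ext ?_⟩
    change (xi (radB j t * (w : ℂ).re), (j : ℝ) + radB j t * (w : ℂ).im / 2,
      √(edge g (xi (radB j t * (w : ℂ).re)) (j + radB j t * (w : ℂ).im / 2))) = (u, y, z)
    rw [e1, e2, hX, xi_chi, ← hz, Real.sqrt_sq hz0.le]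

/-- The annulus around hole `j`, `1 ≤ j < g`, on the front. -/
def annulusB (g j : ℕ) (hj : j ∈ Finset.Ico 1 g) : Annulus (Surf g) where
  toMap := mapB g j hj
  inj := mapB_injective g j hj
  isOpen_interior := by
    rw [mapB_image]
    refine isOpen_chart (IsOpen.and ?_ (IsOpen.and ?_ ?_)) <;>
      exact isOpen_lt (by fun_prop) (by fun_prop)

theorem planE {g n : ℕ} (hn : n + 1 < g) (u : Circle) {t : ℝ} (ht : t ∈ Icc (0 : ℝ) 1)
    (hn0 : 1 ≤ n) :
    (u, n + (1 + t) / 3) ∈ Plan g ∧ 0 < edge g u (n + (1 + t) / 3) := by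
  have h1 := ht.1
  have h2 := ht.2
  have h3 : (1 : ℝ) ≤ n := by exact_mod_cast hn0
  have h4 : (n : ℝ) + 2 ≤ g := by exact_mod_cast hn
  refine edge_pos (by linarith) (by linarith) fun k hk => ?_
  have hr := rad_pos k
  have hh := rad_le_half k
  have hu := circle_re_le u
  have hk3 : (1 / ((k : ℝ) + 2)) ≤ 1 / 3 := by
    have : (1 : ℝ) ≤ k := by exact_mod_cast (Finset.mem_Ico.1 hk).1
    apply one_div_le_one_div_of_le <;> linarith
  have key : 1 / 9 ≤ ((n : ℝ) + (1 + t) / 3 - k) ^ 2 := by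
    rcases le_or_gt k n with h | h
    · have : (k : ℝ) ≤ n := by exact_mod_cast h
      nlinarith
    · have : (n : ℝ) + 1 ≤ k := by exact_mod_cast h
      nlinarith
  unfold hole
  nlinarith

/-- The annulus on the front that separates the holes `0, …, n` from the remaining holes and from
the outer boundary; `t` runs upwards and `w` runs to the left. -/
def mapE (g n : ℕ) (hn : 1 ≤ n ∧ n + 1 < g) : C(Circle × unitInterval, Surf g) where
  toFun a := ⟨(a.1⁻¹, n + (1 + a.2) / 3, √(edge g a.1⁻¹ (n + (1 + a.2) / 3))),
    (planE hn.2 _ a.2.2 hn.1).1, Real.sq_sqrt (planE hn.2 _ a.2.2 hn.1).2.le⟩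
  continuous_toFun := by
    have h1 : Continuous fun a : Circle × unitInterval => a.1⁻¹ := by fun_prop
    have h2 : Continuous fun a : Circle × unitInterval => (n : ℝ) + (1 + a.2) / 3 := by fun_prop
    have h3 := (continuous_edge g).comp (h1.prodMk h2)
    exact (h1.prodMk (h2.prodMk h3.sqrt)).subtype_mk _

/-- The annulus `mapE`. -/
def annulusE (g n : ℕ) (hn : 1 ≤ n ∧ n + 1 < g) : Annulus (Surf g) where
  toMap := mapE g n hn
  inj a b h := by
    have hx : a.1⁻¹ = b.1⁻¹ := congrArg (fun p : Surf g => p.1.1) h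
    have hy : (n : ℝ) + (1 + a.2) / 3 = n + (1 + b.2) / 3 :=
      congrArg (fun p : Surf g => p.1.2.1) h
    exact Prod.ext (inv_injective hx) (Subtype.ext (by linarith))
  isOpen_interior := by
    have : mapE g n hn '' {a | (a.2 : ℝ) ∈ Ioo (0 : ℝ) 1} =
        {p : Surf g | 0 < p.1.2.2 ∧ ((n : ℝ) + 1 / 3 < p.1.2.1 ∧ p.1.2.1 < n + 2 / 3)} := by
      apply Subset.antisymm
      · rintro _ ⟨a, ⟨h0, h1⟩, rfl⟩
        refine ⟨Real.sqrt_pos.2 (planE hn.2 _ a.2.2 hn.1).2, ?_, ?_⟩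
        · change (n : ℝ) + 1 / 3 < n + (1 + a.2) / 3
          linarith
        · change (n : ℝ) + (1 + a.2) / 3 < n + 2 / 3
          linarith
      · rintro ⟨⟨u, y, z⟩, hP, hz⟩ ⟨h1, h2, h3⟩
        simp only at hP hz h1 h2 h3
        refine ⟨(u⁻¹, ⟨3 * (y - n) - 1, by linarith, by linarith⟩), ⟨?_, ?_⟩, Subtype.ext ?_⟩
        · change (0 : ℝ) < 3 * (y - n) - 1
          linarith
        · change 3 * (y - n) - 1 < (1 : ℝ)
          linarith
        · change (u⁻¹⁻¹, (n : ℝ) + (1 + (3 * (y - n) - 1)) / 3,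
            √(edge g u⁻¹⁻¹ (n + (1 + (3 * (y - n) - 1)) / 3))) = (u, y, z)
          have e : (n : ℝ) + (1 + (3 * (y - n) - 1)) / 3 = y := by ring
          rw [e, inv_inv, ← hz, Real.sqrt_sq h1.le]
    rw [this]
    refine IsOpen.and ?_ (IsOpen.and ?_ ?_) <;> exact isOpen_lt (by fun_prop) (by fun_prop)

/-! ### The generators

`T_{a_1}, …, T_{a_g}`, `T_{b_2}, …, T_{b_g}`, `T_{c_1}, …, T_{c_{g-1}}`, the bounding pair maps
`T_{α_n} T_{ι(α_n)}⁻¹` for `1 ≤ n ≤ g - 2`, and the hyperelliptic involution `ι`. The curves are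
numbered from `1` and the holes from `0`, so that `a_{i+1}`, `b_{i+1}` belong to hole `i`. -/

/-- The twist about `a_{i+1}`, the double of an arc from hole `i` to the outer boundary. -/
def twistA (g i : ℕ) (hi : i < g) : Surf g ≃ₜ Surf g := dehnTwist (stripA g i hi).annulus

/-- The twist about `b_{i+1}`, the curve around hole `i`. -/
def twistB (g i : ℕ) (hi : i ∈ Finset.Ico 1 g) : Surf g ≃ₜ Surf g := dehnTwist (annulusB g i hi)

/-- The twist about `c_{i+1}`, the double of an arc from hole `i` to hole `i + 1`. -/
def twistC (g i : ℕ) (hi : i + 1 < g) : Surf g ≃ₜ Surf g := dehnTwist (stripC g i hi).annulus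

/-- The bounding pair map `T_{α_n} T_{ι(α_n)}⁻¹`, where `α_n` is the curve on the front that
encircles the first `n + 1` holes. -/
def boundingPair (g n : ℕ) (hn : 1 ≤ n ∧ n + 1 < g) : Surf g ≃ₜ Surf g :=
  dehnTwist (annulusE g n hn) * (dehnTwist ((annulusE g n hn).map (hyperelliptic g)))⁻¹

/-- The set of generators of the liftable mapping class group of `cover g`. -/
def generators (g : ℕ) : Set (MCG (Surf g)) :=
  {F | (∃ i hi, F = cls (twistA g i hi)) ∨ (∃ i hi, F = cls (twistB g i hi)) ∨
    (∃ i hi, F = cls (twistC g i hi)) ∨ (∃ n hn, F = cls (boundingPair g n hn)) ∨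
    F = cls (hyperelliptic g)}

end LadderCover

end

/-! A homeomorphism of `S_g` acts on the homotopy classes of maps to the circle, that is, on
`H¹(S_g; ℤ)`; the point is that every generator multiplies the class of the angular coordinate,
which defines the cover, by a sign. The involution `ι` inverts the angle. Along the annuli about
`a_j`, `b_j` and `c_j` the angle has a logarithm, so these twists fix its class. A bounding pair
rotates by the same angle at each height on the front and on the back, so it changes the angle by
the exponential of a globally defined real function.

Let `f'` be a lift of `f`, and let `ε` be the sign of `f`. As the ladder is connected, `f'`
multiplies by `ε` the difference of the angles of two points over the same point of `S_g`. This
gives `f' h = h ^ ε f'`. For a product of generators `ε` is `(-1) ^ k`. -/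

noncomputable section

namespace LadderCover

open Set

section CircleValued

variable {X : Type*} [TopologicalSpace X]

theorem homotopic_iff_exists_eq_mul_exp {F G : C(X, Circle)} :
    F.Homotopic G ↔ ∃ φ : C(X, ℝ), ∀ x, G x = F x * Circle.exp (φ x) := by
  constructor
  · rintro ⟨H⟩
    let K : C(unitInterval × X, Circle) := ⟨fun a => (F a.2)⁻¹ * H a, by fun_prop⟩
    have hK : ∀ x, K (0, x) = Circle.exp ((0 : C(X, ℝ)) x) := fun x => by simp [K]
    refine ⟨(Circle.isCoveringMap_exp.liftHomotopy K 0 hK).curry 1, fun x => ?_⟩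
    have lift_one : Circle.exp (Circle.isCoveringMap_exp.liftHomotopy K 0 hK (1, x)) =
        (F x)⁻¹ * H (1, x) :=
      congrFun (Circle.isCoveringMap_exp.liftHomotopy_lifts K 0 hK) (1, x)
    rw [H.apply_one] at lift_one
    exact eq_mul_of_inv_mul_eq lift_one.symm
  · rintro ⟨φ, hφ⟩
    exact ⟨{ toFun := fun a => F a.2 * Circle.exp (a.1 * φ a.2)
             map_zero_left := fun x => by simp
             map_one_left := fun x => by simp [hφ] }⟩

theorem homotopic_zpow {F G : C(X, Circle)} (h : F.Homotopic G) (n : ℤ) :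
    (F ^ n).Homotopic (G ^ n) :=
  (ContinuousMap.Homotopic.refl (⟨fun z => z ^ n, continuous_zpow n⟩ : C(Circle, Circle))).comp h

/-- The homeomorphism `f` acts by the sign `ε` on the homotopy class of the circle-valued map `θ`,
that is, on the class in `H¹(X; ℤ)` that `θ` represents. -/
def HasSign (θ : C(X, Circle)) (f : X ≃ₜ X) (ε : ℤˣ) : Prop :=
  (θ.comp (f : C(X, X))).Homotopic (θ ^ (ε : ℤ))

namespace HasSign

variable {θ : C(X, Circle)} {f k : X ≃ₜ X} {ε δ : ℤˣ}

theorem of_eq_zpow_mul_exp (φ : C(X, ℝ))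
    (h : ∀ x, θ (f x) = θ x ^ (ε : ℤ) * Circle.exp (φ x)) : HasSign θ f ε :=
  (homotopic_iff_exists_eq_mul_exp.2 ⟨φ, h⟩).symm

theorem exists_eq_zpow_mul_exp (hf : HasSign θ f ε) :
    ∃ φ : C(X, ℝ), ∀ x, θ (f x) = θ x ^ (ε : ℤ) * Circle.exp (φ x) :=
  homotopic_iff_exists_eq_mul_exp.1 hf.symm

theorem one (θ : C(X, Circle)) : HasSign θ 1 1 := by
  change θ.Homotopic (θ ^ (1 : ℤ))
  rw [zpow_one]

theorem mul (hf : HasSign θ f ε) (hk : HasSign θ k δ) : HasSign θ (f * k) (ε * δ) := by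
  have h : (θ.comp ((f * k : X ≃ₜ X) : C(X, X))).Homotopic ((θ.comp (k : C(X, X))) ^ (ε : ℤ)) :=
    hf.comp (.refl (k : C(X, X)))
  refine h.trans ?_
  rw [Units.val_mul, mul_comm, zpow_mul]
  exact homotopic_zpow hk ε

theorem inv (hf : HasSign θ f ε) : HasSign θ f⁻¹ ε := by
  have h : ((θ.comp ((f⁻¹ : X ≃ₜ X) : C(X, X))) ^ (ε : ℤ)).Homotopic θ := by
    have h' := hf.symm.comp (.refl ((f⁻¹ : X ≃ₜ X) : C(X, X)))
    rwa [ContinuousMap.comp_assoc, show (f : C(X, X)).comp ((f⁻¹ : X ≃ₜ X) : C(X, X)) =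
      ContinuousMap.id X from ContinuousMap.ext f.apply_symm_apply] at h'
  have h2 := homotopic_zpow h ε
  rwa [← zpow_mul, ← Units.val_mul, Int.units_mul_self, Units.val_one, zpow_one] at h2

theorem of_cls_eq (hf : HasSign θ f ε) (h : cls f = cls k) : HasSign θ k ε := by
  obtain ⟨H⟩ : Isotopic f k := (Con.eq _).1 h
  exact (ContinuousMap.Homotopic.comp (.refl θ) ⟨H.toHomotopy.symm⟩).trans hf

theorem list_prod_ofFn : ∀ {n : ℕ} {f : Fin n → X ≃ₜ X} {ε : Fin n → ℤˣ},
    (∀ j, HasSign θ (f j) (ε j)) → HasSign θ (List.ofFn f).prod (∏ j, ε j)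
  | 0, _, _, _ => by simpa using one θ
  | n + 1, f, ε, h => by
    rw [List.ofFn_succ, List.prod_cons, Fin.prod_univ_succ]
    exact (h 0).mul (list_prod_ofFn fun j => h j.succ)

end HasSign

end CircleValued

section DehnTwist

variable {X : Type*} [TopologicalSpace X]

theorem continuous_of_comp_isClosedEmbedding {A Y : Type*} [TopologicalSpace A]
    [TopologicalSpace Y] {i : A → X} (hi : Topology.IsClosedEmbedding i) {U : Set X}
    (hU : IsOpen U) (hUi : U ⊆ range i) {F : X → Y} (hF : Continuous (F ∘ i))
    (hFU : ContinuousOn F Uᶜ) : Continuous F := by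
  have hrange : ContinuousOn F (range i) := by
    rwa [← image_univ, hi.isInducing.continuousOn_image_iff, continuousOn_univ]
  rw [← continuousOn_univ]
  refine (hrange.union_of_isClosed hFU hi.isClosed_range hU.isClosed_compl).mono fun x _ => ?_
  exact (em (x ∈ U)).imp (@hUi x) id

theorem stdTwist_eq_self {a : Circle × unitInterval} (ha : (a.2 : ℝ) ∉ Ioo (0 : ℝ) 1) :
    stdTwist a = a :=
  Prod.ext (by change Circle.exp (2 * Real.pi * a.2) * a.1 = a.1
               rw [exp_twist_boundary _ ha, one_mul]) rfl

variable [T2Space X]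

theorem dehnTwist_toMap (e : Annulus X) (a : Circle × unitInterval) :
    dehnTwist e (e.toMap a) = e.toMap (stdTwist a) :=
  e.extend_apply _ a

theorem dehnTwist_of_notMem (e : Annulus X) {x : X} (hx : x ∉ range e.toMap) :
    dehnTwist e x = x :=
  e.extend_of_notMem _ fun a ha => hx ⟨a, ha⟩

theorem dehnTwist_map_apply (e : Annulus X) (k : X ≃ₜ X) (x : X) :
    dehnTwist (e.map k) (k x) = k (dehnTwist e x) := by
  by_cases hx : x ∈ range e.toMap
  · obtain ⟨a, rfl⟩ := hx
    rw [dehnTwist_toMap]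
    exact dehnTwist_toMap (e.map k) a
  · rw [dehnTwist_of_notMem e hx, dehnTwist_of_notMem]
    rintro ⟨a, ha⟩
    exact hx ⟨a, k.injective ha⟩

theorem hasSign_dehnTwist {θ : C(X, Circle)} (e : Annulus X) {φ : C(Circle × unitInterval, ℝ)}
    (hφ : ∀ a, θ (e.toMap a) = Circle.exp (φ a)) : HasSign θ (dehnTwist e) 1 := by
  let δ : X → ℝ := Function.extend e.toMap (fun a => φ (stdTwist a) - φ a) 0
  have δ_toMap (a) : δ (e.toMap a) = φ (stdTwist a) - φ a := e.inj.extend_apply _ _ a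
  have δ_outside {x} (hx : x ∉ range e.toMap) : δ x = 0 := Function.extend_apply' _ _ _ hx
  have continuous_δ : Continuous δ := by
    refine continuous_of_comp_isClosedEmbedding (e.toMap.continuous.isClosedEmbedding e.inj)
      e.isOpen_interior (image_subset_range _ _) ?_
      (continuousOn_const (c := (0 : ℝ)) |>.congr fun x hx => ?_)
    · rw [show δ ∘ e.toMap = fun a => φ (stdTwist a) - φ a from funext δ_toMap]
      fun_prop
    · by_cases hxe : x ∈ range e.toMap
      · obtain ⟨a, rfl⟩ := hxe
        rw [δ_toMap, stdTwist_eq_self fun ha => hx ⟨a, ha, rfl⟩, sub_self]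
      · exact δ_outside hxe
  suffices h : ∀ x, θ (dehnTwist e x) = θ x * Circle.exp (δ x) from
    .of_eq_zpow_mul_exp ⟨δ, continuous_δ⟩ (by simpa using h)
  intro x
  by_cases hx : x ∈ range e.toMap
  · obtain ⟨a, rfl⟩ := hx
    rw [dehnTwist_toMap, δ_toMap, hφ, hφ, ← Circle.exp_add, add_sub_cancel]
  · rw [dehnTwist_of_notMem e hx, δ_outside hx, Circle.exp_zero, mul_one]

end DehnTwist

section Generators

variable {g n : ℕ}

/-- The angular coordinate of the surface; its class in `H¹(Surf g; ℤ)` is the one that defines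
the infinite cyclic cover `cover g`. -/
def angle (g : ℕ) : C(Surf g, Circle) := ⟨fun p => p.1.1, by fun_prop⟩

theorem hyperelliptic_hyperelliptic (p : Surf g) : hyperelliptic g (hyperelliptic g p) = p :=
  (hyperelliptic g).left_inv p

theorem hasSign_hyperelliptic (g : ℕ) : HasSign (angle g) (hyperelliptic g) (-1) :=
  .of_eq_zpow_mul_exp 0 fun p => by
    change p.1.1⁻¹ = _
    simp [angle]

theorem hasSign_dehnTwist_strip (s : Strip g) : HasSign (angle g) (dehnTwist s.annulus) 1 :=
  have := s.continuous_xc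
  hasSign_dehnTwist s.annulus (φ := ⟨fun a => 2 * Real.arcsin (s.xc a.2 / √2), by fun_prop⟩)
    fun _ => rfl

theorem hasSign_twistB {j : ℕ} (hj : j ∈ Finset.Ico 1 g) :
    HasSign (angle g) (twistB g j hj) 1 :=
  hasSign_dehnTwist (annulusB g j hj)
    (φ := ⟨fun a => 2 * Real.arcsin (radB j a.2 * (a.1 : ℂ).re / √2), by unfold radB; fun_prop⟩)
    fun _ => rfl

/-- At height `y`, the twist in `annulusE g n hn` rotates by the angle `2π · ramp n y`. -/
def ramp (n : ℕ) (y : ℝ) : ℝ := max 0 (min 1 (3 * (y - n) - 1))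

theorem continuous_ramp (n : ℕ) : Continuous (ramp n) := by
  unfold ramp; fun_prop

theorem ramp_height (n : ℕ) (t : unitInterval) : ramp n (n + (1 + t) / 3) = t := by
  have e : 3 * ((n : ℝ) + (1 + t) / 3 - n) - 1 = t := by ring
  rw [ramp, e, min_eq_right t.2.2, max_eq_right t.2.1]

theorem exp_ramp_eq_one {y : ℝ} (hy : y ∉ Icc ((n : ℝ) + 1 / 3) (n + 2 / 3)) :
    Circle.exp (2 * Real.pi * ramp n y) = 1 := by
  rw [mem_Icc, not_and_or, not_le, not_le] at hy
  unfold ramp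
  rcases hy with below | above
  · rw [max_eq_left (min_le_of_right_le (by linarith)), mul_zero, Circle.exp_zero]
  · rw [min_eq_left (by linarith), max_eq_right zero_le_one, mul_one, Circle.exp_two_pi]

theorem annulusE_front (hn : 1 ≤ n ∧ n + 1 < g) (a : Circle × unitInterval) :
    0 < ((annulusE g n hn).toMap a).1.2.2 :=
  Real.sqrt_pos.2 (planE hn.2 _ a.2.2 hn.1).2

theorem mem_range_annulusE (hn : 1 ≤ n ∧ n + 1 < g) {p : Surf g} (hz : 0 ≤ p.1.2.2)
    (hy : p.1.2.1 ∈ Icc ((n : ℝ) + 1 / 3) (n + 2 / 3)) :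
    p ∈ range (annulusE g n hn).toMap := by
  obtain ⟨⟨u, y, z⟩, _, hz2⟩ := p
  simp only at hz hy hz2
  have e : (n : ℝ) + (1 + (3 * (y - n) - 1)) / 3 = y := by ring
  refine ⟨(u⁻¹, ⟨3 * (y - n) - 1, by linarith [hy.1], by linarith [hy.2]⟩), Subtype.ext ?_⟩
  change (u⁻¹⁻¹, (n : ℝ) + (1 + (3 * (y - n) - 1)) / 3,
    √(edge g u⁻¹⁻¹ (n + (1 + (3 * (y - n) - 1)) / 3))) = (u, y, z)
  rw [e, inv_inv, ← hz2, Real.sqrt_sq hz]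

theorem dehnTwist_annulusE_of_back (hn : 1 ≤ n ∧ n + 1 < g) {p : Surf g} (hz : p.1.2.2 ≤ 0) :
    dehnTwist (annulusE g n hn) p = p :=
  dehnTwist_of_notMem _ fun ⟨a, ha⟩ => (annulusE_front hn a).not_ge (ha ▸ hz)

theorem dehnTwist_annulusE_height (hn : 1 ≤ n ∧ n + 1 < g) (p : Surf g) :
    (dehnTwist (annulusE g n hn) p).1.2.1 = p.1.2.1 := by
  by_cases hp : p ∈ range (annulusE g n hn).toMap
  · obtain ⟨a, rfl⟩ := hp
    rw [dehnTwist_toMap]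
    rfl
  · rw [dehnTwist_of_notMem _ hp]

theorem angle_dehnTwist_annulusE_of_front (hn : 1 ≤ n ∧ n + 1 < g) {p : Surf g}
    (hz : 0 ≤ p.1.2.2) : angle g (dehnTwist (annulusE g n hn) p) =
      angle g p * (Circle.exp (2 * Real.pi * ramp n p.1.2.1))⁻¹ := by
  by_cases hp : p ∈ range (annulusE g n hn).toMap
  · obtain ⟨⟨w, t⟩, rfl⟩ := hp
    rw [dehnTwist_toMap]
    change (Circle.exp (2 * Real.pi * t) * w)⁻¹ =
      w⁻¹ * (Circle.exp (2 * Real.pi * ramp n (n + (1 + t) / 3)))⁻¹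
    rw [ramp_height, mul_inv_rev]
  · rw [dehnTwist_of_notMem _ hp, exp_ramp_eq_one (mt (mem_range_annulusE hn hz) hp), inv_one,
      mul_one]

theorem angle_boundingPair (hn : 1 ≤ n ∧ n + 1 < g) (p : Surf g) :
    angle g (boundingPair g n hn p) =
      angle g p * (Circle.exp (2 * Real.pi * ramp n p.1.2.1))⁻¹ := by
  set T := dehnTwist (annulusE g n hn) with hT
  set ι := hyperelliptic g
  obtain ⟨s, rfl⟩ := (dehnTwist ((annulusE g n hn).map ι)).surjective p
  have pair_eq : boundingPair g n hn (dehnTwist ((annulusE g n hn).map ι) s) = T s :=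
    congrArg T ((dehnTwist _).symm_apply_apply s)
  have conj_eq : dehnTwist ((annulusE g n hn).map ι) s = ι (T (ι s)) := by
    rw [← dehnTwist_map_apply, hyperelliptic_hyperelliptic]
  have height_eq : (ι (T (ι s))).1.2.1 = s.1.2.1 := dehnTwist_annulusE_height hn (ι s)
  rw [pair_eq, conj_eq, height_eq]
  rcases le_total 0 s.1.2.2 with front | back
  · have fixed : T (ι s) = ι s := dehnTwist_annulusE_of_back hn (neg_nonpos.2 front)
    rw [fixed, hyperelliptic_hyperelliptic]
    exact angle_dehnTwist_annulusE_of_front hn front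
  · have rotated : angle g (ι (T (ι s))) =
        (s.1.1⁻¹ * (Circle.exp (2 * Real.pi * ramp n s.1.2.1))⁻¹)⁻¹ :=
      congrArg (·⁻¹) (angle_dehnTwist_annulusE_of_front hn (p := ι s) (neg_nonneg.2 back))
    rw [rotated, hT, dehnTwist_annulusE_of_back hn back, mul_inv_rev, inv_inv, inv_inv,
      mul_comm, inv_mul_cancel_left]
    rfl

theorem hasSign_boundingPair (hn : 1 ≤ n ∧ n + 1 < g) :
    HasSign (angle g) (boundingPair g n hn) 1 := by
  have := continuous_ramp n
  refine .of_eq_zpow_mul_exp ⟨fun p => -(2 * Real.pi * ramp n p.1.2.1), by fun_prop⟩ fun p => ?_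
  simp [angle_boundingPair, Circle.exp_neg]

theorem hasSign_one_of_mem_generators {f : Surf g ≃ₜ Surf g} (hf : cls f ∈ generators g)
    (hne : cls f ≠ cls (hyperelliptic g)) : HasSign (angle g) f 1 := by
  rcases hf with ⟨i, hi, h⟩ | ⟨i, hi, h⟩ | ⟨i, hi, h⟩ | ⟨n, hn, h⟩ | h
  · exact (hasSign_dehnTwist_strip _).of_cls_eq h.symm
  · exact (hasSign_twistB hi).of_cls_eq h.symm
  · exact (hasSign_dehnTwist_strip _).of_cls_eq h.symm
  · exact (hasSign_boundingPair hn).of_cls_eq h.symm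
  · exact absurd h hne

theorem hasSign_of_mem_or_inv_mem_generators {f : Surf g ≃ₜ Surf g}
    [Decidable (cls f = cls (hyperelliptic g))]
    (hf : cls f ∈ generators g ∨ (cls f)⁻¹ ∈ generators g) :
    HasSign (angle g) f (if cls f = cls (hyperelliptic g) then -1 else 1) := by
  split_ifs with h
  · exact (hasSign_hyperelliptic g).of_cls_eq h.symm
  rcases hf with hf | hf
  · exact hasSign_one_of_mem_generators hf h
  · have hne : cls f⁻¹ ≠ cls (hyperelliptic g) := fun h' => h (congrArg (·⁻¹) h')
    exact inv_inv f ▸ (hasSign_one_of_mem_generators (f := f⁻¹) hf hne).inv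

end Generators

section Lifts

variable {X Y : Type*} [TopologicalSpace X] [TopologicalSpace Y] {q : Y → X}

theorem IsLift.one (q : Y → X) : IsLift q 1 1 := fun _ => rfl

theorem IsLift.mul {f k : X ≃ₜ X} {f' k' : Y ≃ₜ Y} (hf : IsLift q f f') (hk : IsLift q k k') :
    IsLift q (f * k) (f' * k') :=
  fun y => (hf (k' y)).trans (congrArg f (hk y))

theorem IsLift.list_prod_ofFn : ∀ {n : ℕ} {f : Fin n → X ≃ₜ X} {f' : Fin n → Y ≃ₜ Y},
    (∀ j, IsLift q (f j) (f' j)) → IsLift q (List.ofFn f).prod (List.ofFn f').prod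
  | 0, _, _, _ => by simpa using IsLift.one q
  | n + 1, f, f', h => by
    rw [List.ofFn_succ, List.ofFn_succ, List.prod_cons, List.prod_cons]
    exact (h 0).mul (list_prod_ofFn fun j => h j.succ)

theorem cls_list_prod (l : List (X ≃ₜ X)) : cls l.prod = (l.map cls).prod :=
  map_list_prod (isotopyCon X).mk' l

theorem eq_of_forall_exp_eq_one [PreconnectedSpace Y] {δ : C(Y, ℝ)}
    (h : ∀ y, Circle.exp (δ y) = 1) (y y' : Y) : δ y = δ y' := by
  have const : ⇑δ = fun _ => δ y' :=
    Circle.isCoveringMap_exp.eq_of_comp_eq δ.continuous continuous_const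
      (funext fun x => (h x).trans (h y').symm) y' rfl
  exact congrFun const y

theorem HasSign.sub_eq_of_isLift [PreconnectedSpace Y] {q : C(Y, X)} {θ : C(X, Circle)}
    {f : X ≃ₜ X} {f' : Y ≃ₜ Y} {ε : ℤˣ} (hf : HasSign θ f ε) (hlift : IsLift q f f')
    {α : C(Y, ℝ)} (hα : ∀ y, Circle.exp (α y) = θ (q y)) {y y' : Y} (hq : q y = q y') :
    α (f' y') - α (f' y) = (ε : ℤ) * (α y' - α y) := by
  obtain ⟨φ, hφ⟩ := hf.exists_eq_zpow_mul_exp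
  let δ : C(Y, ℝ) := ⟨fun y => α (f' y) - ((ε : ℤ) • α y + φ (q y)), by fun_prop⟩
  have exp_δ (y : Y) : Circle.exp (δ y) = 1 := by
    change Circle.exp (α (f' y) - ((ε : ℤ) • α y + φ (q y))) = 1
    rw [Circle.exp_sub, Circle.exp_add, Circle.exp_zsmul, hα, hα, hlift y, hφ, div_self']
  have δ_eq : α (f' y) - ((ε : ℤ) • α y + φ (q y)) = α (f' y') - ((ε : ℤ) • α y' + φ (q y')) :=
    eq_of_forall_exp_eq_one exp_δ y y'
  rw [hq, zsmul_eq_mul, zsmul_eq_mul] at δ_eq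
  linear_combination -δ_eq

end Lifts

section Ladder

variable {g : ℕ}

/-- The planar domain unrolled along its angular coordinate; `Ladder g` is its double. -/
def unrolledPlan (g : ℕ) : Set (ℝ × ℝ) := {p | (Circle.exp (2 * Real.pi * p.1), p.2) ∈ Plan g}

theorem hole_exp (j : ℕ) (θ y : ℝ) : hole j (Circle.exp θ) y =
    (1 - Real.cos θ) + (2 * (y - j)) ^ 2 - (1 / ((j : ℝ) + 2)) ^ 2 := by
  rw [hole, Circle.coe_exp, Complex.exp_ofReal_mul_I_re]

theorem mem_unrolledPlan_of_cos_le {x x' y : ℝ} (h : (x, y) ∈ unrolledPlan g)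
    (hcos : Real.cos (2 * Real.pi * x') ≤ Real.cos (2 * Real.pi * x)) :
    (x', y) ∈ unrolledPlan g := by
  refine ⟨h.1, h.2.1, fun j hj => ?_⟩
  have := h.2.2 j hj
  simp only [hole_exp] at this ⊢
  linarith

theorem cos_two_pi_mul_eq_neg_cos_abs_sub (m : ℤ) (x : ℝ) :
    Real.cos (2 * Real.pi * x) = -Real.cos (2 * Real.pi * |m + 1 / 2 - x|) :=
  calc
    Real.cos (2 * Real.pi * x)
      = Real.cos (Real.pi - 2 * Real.pi * (m + 1 / 2 - x) + m * (2 * Real.pi)) := by ring_nf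
    _ = -Real.cos (2 * Real.pi * (m + 1 / 2 - x)) := by
      rw [Real.cos_add_int_mul_two_pi, Real.cos_pi_sub]
    _ = -Real.cos (2 * Real.pi * |m + 1 / 2 - x|) := by
      rw [← Real.cos_abs, abs_mul, abs_of_pos Real.two_pi_pos]

theorem cos_two_pi_mul_le {m : ℤ} {x x' : ℝ} (hx : |m + 1 / 2 - x| ≤ 1 / 2)
    (hx' : |m + 1 / 2 - x'| ≤ |m + 1 / 2 - x|) :
    Real.cos (2 * Real.pi * x') ≤ Real.cos (2 * Real.pi * x) := by
  rw [cos_two_pi_mul_eq_neg_cos_abs_sub m x, cos_two_pi_mul_eq_neg_cos_abs_sub m x', neg_le_neg_iff]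
  have := Real.pi_pos
  apply Real.cos_le_cos_of_nonneg_of_le_pi
  · positivity
  · nlinarith
  · gcongr

theorem half_line_mem_unrolledPlan (m : ℤ) {y : ℝ} (hy : y ∈ Icc (0 : ℝ) g) :
    ((m : ℝ) + 1 / 2, y) ∈ unrolledPlan g := by
  refine ⟨hy.1, hy.2, fun j _ => ?_⟩
  have := rad_pos j
  have := rad_le_half j
  simp only [hole_exp, cos_two_pi_mul_eq_neg_cos_abs_sub m, sub_self, abs_zero, mul_zero,
    Real.cos_zero]
  nlinarith [sq_nonneg (2 * (y - j))]

theorem bottom_mem_unrolledPlan (x : ℝ) : (x, 0) ∈ unrolledPlan g := by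
  refine ⟨le_rfl, g.cast_nonneg, fun j hj => (hole_pos_of_far ?_).le⟩
  have : (1 : ℝ) ≤ j := by exact_mod_cast (Finset.mem_Ico.1 hj).1
  nlinarith

theorem joinedIn_of_forall_mem_uIcc_fst {s : Set (ℝ × ℝ)} {x x' y : ℝ}
    (h : ∀ t ∈ uIcc x x', (t, y) ∈ s) : JoinedIn s (x, y) (x', y) := by
  refine .of_segment_subset ?_
  rw [← Prod.image_mk_segment_left, segment_eq_uIcc]
  exact image_subset_iff.2 h

theorem joinedIn_of_forall_mem_uIcc_snd {s : Set (ℝ × ℝ)} {x y y' : ℝ}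
    (h : ∀ t ∈ uIcc y y', (x, t) ∈ s) : JoinedIn s (x, y) (x, y') := by
  refine .of_segment_subset ?_
  rw [← Prod.image_mk_segment_right, segment_eq_uIcc]
  exact image_subset_iff.2 h

/-- Moving away from the centres of the holes, then down between two columns of holes, then along
the bottom. -/
theorem isPathConnected_unrolledPlan (g : ℕ) : IsPathConnected (unrolledPlan g) := by
  refine ⟨(0, 0), bottom_mem_unrolledPlan 0, fun {p} hp => .symm ?_⟩
  obtain ⟨x, y⟩ := p
  set m := ⌊x⌋
  have hm : |m + 1 / 2 - x| ≤ 1 / 2 := by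
    rw [abs_le]
    constructor <;> linarith [Int.floor_le x, Int.lt_floor_add_one x]
  have away : JoinedIn (unrolledPlan g) (x, y) ((m : ℝ) + 1 / 2, y) :=
    joinedIn_of_forall_mem_uIcc_fst fun t ht =>
      mem_unrolledPlan_of_cos_le hp (cos_two_pi_mul_le hm (abs_sub_right_of_mem_uIcc ht))
  have down : JoinedIn (unrolledPlan g) ((m : ℝ) + 1 / 2, y) ((m : ℝ) + 1 / 2, 0) :=
    joinedIn_of_forall_mem_uIcc_snd fun t ht => by
      rw [uIcc_of_ge hp.1] at ht
      exact half_line_mem_unrolledPlan m ⟨ht.1, ht.2.trans hp.2.1⟩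
  have along : JoinedIn (unrolledPlan g) ((m : ℝ) + 1 / 2, 0) (0, 0) :=
    joinedIn_of_forall_mem_uIcc_fst fun t _ => bottom_mem_unrolledPlan t
  exact (away.trans down).trans along

/-- The copy of the unrolled planar domain on the front (`σ = 1`) or the back (`σ = -1`) of the
ladder. -/
def sheet (g : ℕ) (σ : ℤˣ) : C(unrolledPlan g, Ladder g) where
  toFun p := ⟨(p.1.1, p.1.2, (σ : ℤ) * √(edge g (Circle.exp (2 * Real.pi * p.1.1)) p.1.2)), p.2, by
    rw [mul_pow, Real.sq_sqrt (edge_nonneg p.2), ← Int.cast_pow, ← Units.val_pow_eq_pow_val,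
      Int.units_sq, Units.val_one, Int.cast_one, one_mul]⟩
  continuous_toFun := by
    have h : Continuous fun p : unrolledPlan g => (Circle.exp (2 * Real.pi * p.1.1), p.1.2) := by
      fun_prop
    have := (continuous_edge g).comp h
    fun_prop

theorem exists_sheet_eq (p : Ladder g) : ∃ σ a, sheet g σ a = p := by
  obtain ⟨⟨x, y, z⟩, hP, hz⟩ := p
  have hz' : z ^ 2 = √(edge g (Circle.exp (2 * Real.pi * x)) y) ^ 2 := by
    rw [Real.sq_sqrt (edge_nonneg hP), hz]
  rcases sq_eq_sq_iff_eq_or_eq_neg.1 hz' with front | back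
  · exact ⟨1, ⟨(x, y), hP⟩, Subtype.ext (by simp [sheet, front])⟩
  · exact ⟨-1, ⟨(x, y), hP⟩, Subtype.ext (by simp [sheet, back])⟩

theorem sheet_origin (σ : ℤˣ) :
    sheet g σ ⟨(0, 0), bottom_mem_unrolledPlan 0⟩ =
      ⟨(0, 0, 0), bottom_mem_unrolledPlan 0, by simp [edge]⟩ :=
  Subtype.ext (by simp [sheet, edge])

instance preconnectedSpace_ladder (g : ℕ) : PreconnectedSpace (Ladder g) := by
  have := isPathConnected_iff_pathConnectedSpace.1 (isPathConnected_unrolledPlan g)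
  have univ_eq : (univ : Set (Ladder g)) = range (sheet g 1) ∪ range (sheet g (-1)) := by
    refine (eq_univ_of_forall fun p => ?_).symm
    obtain ⟨σ, a, rfl⟩ := exists_sheet_eq p
    exact (Int.units_eq_one_or σ).imp (fun h => ⟨a, by rw [h]⟩) fun h => ⟨a, by rw [h]⟩
  refine ⟨univ_eq ▸ ?_⟩
  exact (isPreconnected_range (sheet g 1).continuous).union _ ⟨_, sheet_origin 1⟩
    ⟨_, sheet_origin (-1)⟩ (isPreconnected_range (sheet g (-1)).continuous)

end Ladder

section HandleShift

variable {g : ℕ}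

theorem handleShift_zpow_apply (n : ℤ) (p : Ladder g) :
    ((handleShift g ^ n) p).1 = (p.1.1 + n, p.1.2) := by
  induction n generalizing p with
  | zero => simp
  | succ n ih =>
    rw [zpow_add_one, Homeomorph.mul_apply, ih]
    simp [handleShift, add_assoc, add_comm (1 : ℝ)]
  | pred n ih =>
    rw [zpow_sub_one, Homeomorph.mul_apply, ih]
    change (p.1.1 - 1 + _, p.1.2) = _
    push_cast
    ring_nf

theorem handleShift_ne_inv (g : ℕ) : handleShift g ≠ (handleShift g)⁻¹ := by
  intro h
  have shifts_eq := congrArg (fun k : Ladder g ≃ₜ Ladder g =>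
    (k ⟨(0, 0, 0), bottom_mem_unrolledPlan 0, by simp [edge]⟩).1.1) h
  change (0 : ℝ) + 1 = 0 - 1 at shifts_eq
  norm_num at shifts_eq

theorem cover_handleShift (p : Ladder g) : cover g (handleShift g p) = cover g p :=
  Subtype.ext (Prod.ext (exp_shift p.1.1) rfl)

theorem HasSign.semiconjBy_handleShift {f : Surf g ≃ₜ Surf g} {f' : Ladder g ≃ₜ Ladder g}
    {ε : ℤˣ} (hf : HasSign (angle g) f ε) (hlift : IsLift (cover g) f f') :
    SemiconjBy f' (handleShift g) (handleShift g ^ (ε : ℤ)) := by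
  let q : C(Ladder g, Surf g) := ⟨cover g, by unfold cover; fun_prop⟩
  let α : C(Ladder g, ℝ) := ⟨fun p => 2 * Real.pi * p.1.1, by fun_prop⟩
  ext p : 1
  have cover_eq : cover g (f' (handleShift g p)) = cover g (f' p) := by
    rw [hlift, hlift, cover_handleShift]
  have angle_shift : 2 * Real.pi * (f' (handleShift g p)).1.1 - 2 * Real.pi * (f' p).1.1 =
      (ε : ℤ) * (2 * Real.pi * (p.1.1 + 1) - 2 * Real.pi * p.1.1) :=
    hf.sub_eq_of_isLift (q := q) hlift (α := α) (fun _ => rfl) (cover_handleShift p).symm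
  have x_eq : (f' (handleShift g p)).1.1 = (f' p).1.1 + (ε : ℤ) :=
    mul_left_cancel₀ Real.two_pi_pos.ne' (by linear_combination angle_shift)
  have yz_eq : (f' (handleShift g p)).1.2 = (f' p).1.2 :=
    congrArg (fun s : Surf g => s.1.2) cover_eq
  have point_eq : (f' (handleShift g p)).1 = ((f' p).1.1 + (ε : ℤ), (f' p).1.2) :=
    Prod.ext x_eq yz_eq
  rw [Homeomorph.mul_apply, Homeomorph.mul_apply]
  exact Subtype.ext (point_eq.trans (handleShift_zpow_apply (ε : ℤ) (f' p)).symm)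

end HandleShift

section Group

variable {G : Type*} [Group G] {f h : G}

theorem commutes_iff_sign_eq_one (hne : h ≠ h⁻¹) {ε : ℤˣ} (H : SemiconjBy f h (h ^ (ε : ℤ))) :
    h * f = f * h ↔ ε = 1 := by
  rcases Int.units_eq_one_or ε with rfl | rfl
  · simpa using H.eq.symm
  · refine iff_of_false (fun commutes => hne ?_) (by decide)
    have inverts : f * h = h⁻¹ * f := by simpa using H.eq
    exact mul_right_cancel (commutes.trans inverts)

theorem inverts_iff_sign_eq_neg_one (hne : h ≠ h⁻¹) {ε : ℤˣ}
    (H : SemiconjBy f h (h ^ (ε : ℤ))) : h * f = f * h⁻¹ ↔ ε = -1 := by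
  rcases Int.units_eq_one_or ε with rfl | rfl
  · refine iff_of_false (fun inverts => hne ?_) (by decide)
    have commutes : f * h = h * f := by simpa using H.eq
    exact mul_left_cancel (commutes.trans inverts)
  · simpa using H.inv_right.eq.symm

theorem commute_sq_of_semiconjBy_inv (H : SemiconjBy f h h⁻¹) : Commute (f ^ 2) h := by
  simpa [sq, Commute] using H.inv_right.mul_left H

end Group

section Sign

theorem prod_ite_eq_pow_ncard {M ι : Type*} [CommMonoid M] [Fintype ι] (P : ι → Prop)
    [DecidablePred P] (a : M) : ∏ j, (if P j then a else 1) = a ^ {j | P j}.ncard := by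
  rw [Finset.prod_ite, Finset.prod_const, Finset.prod_const_one, mul_one, ← ncard_coe_finset,
    Finset.coe_filter_univ]

theorem hasSign_of_cls_eq_list_prod {g n : ℕ} {F : Fin n → MCG (Surf g)} {f : Surf g ≃ₜ Surf g}
    (hF : ∀ j, F j ∈ generators g ∨ (F j)⁻¹ ∈ generators g) (hf : cls f = (List.ofFn F).prod) :
    HasSign (angle g) f ((-1) ^ {j | F j = cls (hyperelliptic g)}.ncard) := by
  classical
  choose k hk using fun j => Con.mk'_surjective (c := isotopyCon (Surf g)) (F j)
  obtain rfl : F = fun j => cls (k j) := funext fun j => (hk j).symm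
  have sign := HasSign.list_prod_ofFn fun j => hasSign_of_mem_or_inv_mem_generators (hF j)
  rw [prod_ite_eq_pow_ncard] at sign
  refine sign.of_cls_eq ?_
  rw [hf, cls_list_prod, List.map_ofFn]
  rfl

end Sign

end LadderCover

end

theorem mainTheorem7_general (g : ℕ) :
    (∀ (n : ℕ) (F : Fin n → LadderCover.MCG (LadderCover.Surf g))
      (f : LadderCover.Surf g ≃ₜ LadderCover.Surf g)
      (f' : LadderCover.Ladder g ≃ₜ LadderCover.Ladder g),
      (∀ j, F j ∈ LadderCover.generators g ∨ (F j)⁻¹ ∈ LadderCover.generators g) →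
      LadderCover.cls f = (List.ofFn F).prod →
      LadderCover.IsLift (LadderCover.cover g) f f' →
      (LadderCover.handleShift g * f' = f' * LadderCover.handleShift g ↔
        Even {j | F j = LadderCover.cls (LadderCover.hyperelliptic g)}.ncard) ∧
      (LadderCover.handleShift g * f' = f' * (LadderCover.handleShift g)⁻¹ ↔
        Odd {j | F j = LadderCover.cls (LadderCover.hyperelliptic g)}.ncard) ∧
      (Odd {j | F j = LadderCover.cls (LadderCover.hyperelliptic g)}.ncard →
        LadderCover.handleShift g * f' ^ 2 = f' ^ 2 * LadderCover.handleShift g)) ∧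
    (∀ (f : LadderCover.Surf g ≃ₜ LadderCover.Surf g)
      (f' : LadderCover.Ladder g ≃ₜ LadderCover.Ladder g),
      LadderCover.IsLift (LadderCover.cover g) f f' →
      LadderCover.handleShift g * f' * LadderCover.handleShift g = f' →
      LadderCover.IsLift (LadderCover.cover g) (f ^ 2) (f' ^ 2) ∧
      LadderCover.handleShift g * f' ^ 2 * (LadderCover.handleShift g)⁻¹ = f' ^ 2) := by
  constructor
  · intro n F f f' hF hf hlift
    have sign := LadderCover.hasSign_of_cls_eq_list_prod hF hf
    have semiconj := sign.semiconjBy_handleShift hlift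
    have hne := LadderCover.handleShift_ne_inv g
    refine ⟨?_, ?_, fun odd => ?_⟩
    · rw [LadderCover.commutes_iff_sign_eq_one hne semiconj,
        neg_one_pow_eq_one_iff_even (by decide)]
    · rw [LadderCover.inverts_iff_sign_eq_neg_one hne semiconj,
        neg_one_pow_eq_neg_one_iff_odd (by decide)]
    · rw [odd.neg_one_pow, Units.val_neg, Units.val_one, zpow_neg_one] at semiconj
      exact (LadderCover.commute_sq_of_semiconjBy_inv semiconj).symm.eq
  · intro f f' hlift hinv
    have semiconj : SemiconjBy f' (LadderCover.handleShift g) (LadderCover.handleShift g)⁻¹ :=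
      eq_inv_mul_of_mul_eq ((mul_assoc _ _ _).symm.trans hinv)
    have commute := (LadderCover.commute_sq_of_semiconjBy_inv semiconj).symm
    refine ⟨?_, mul_inv_eq_of_eq_mul commute.eq⟩
    rw [sq, sq]
    exact hlift.mul hlift

theorem mainTheorem7 (g : ℕ) (hg : 3 ≤ g) :
    (∀ (n : ℕ) (F : Fin n → LadderCover.MCG (LadderCover.Surf g))
      (f : Fin n → LadderCover.Surf g ≃ₜ LadderCover.Surf g)
      (f' : Fin n → LadderCover.Ladder g ≃ₜ LadderCover.Ladder g),
      (∀ j, F j ∈ LadderCover.generators g ∨ (F j)⁻¹ ∈ LadderCover.generators g) →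
      (∀ j, LadderCover.cls (f j) = F j) →
      (∀ j, LadderCover.IsLift (LadderCover.cover g) (f j) (f' j)) →
      LadderCover.IsLift (LadderCover.cover g) (List.ofFn f).prod (List.ofFn f').prod ∧
      (LadderCover.handleShift g * (List.ofFn f').prod =
          (List.ofFn f').prod * LadderCover.handleShift g ↔
        Even {j | F j = LadderCover.cls (LadderCover.hyperelliptic g)}.ncard) ∧
      (LadderCover.handleShift g * (List.ofFn f').prod =
          (List.ofFn f').prod * (LadderCover.handleShift g)⁻¹ ↔
        Odd {j | F j = LadderCover.cls (LadderCover.hyperelliptic g)}.ncard) ∧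
      (Odd {j | F j = LadderCover.cls (LadderCover.hyperelliptic g)}.ncard →
        LadderCover.handleShift g * (List.ofFn f').prod ^ 2 =
          (List.ofFn f').prod ^ 2 * LadderCover.handleShift g)) ∧
    (∀ (f : LadderCover.Surf g ≃ₜ LadderCover.Surf g)
      (f' : LadderCover.Ladder g ≃ₜ LadderCover.Ladder g),
      LadderCover.IsLift (LadderCover.cover g) f f' →
      LadderCover.handleShift g * f' * LadderCover.handleShift g = f' →
      LadderCover.IsLift (LadderCover.cover g) (f ^ 2) (f' ^ 2) ∧
      LadderCover.handleShift g * f' ^ 2 * (LadderCover.handleShift g)⁻¹ = f' ^ 2) := by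
  refine ⟨fun n F f f' hF hf hlift => ?_, (mainTheorem7_general g).2⟩
  have prod_lift := LadderCover.IsLift.list_prod_ofFn hlift
  refine ⟨prod_lift, (mainTheorem7_general g).1 n F _ _ hF ?_ prod_lift⟩
  rw [LadderCover.cls_list_prod, List.map_ofFn, show LadderCover.cls ∘ f = F from funext hf]
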